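/- Let $k$ be an odd positive integer and let $\chi$ be a non-principal primitive Dirichlet character modulo $k$, with complex conjugate $\bar\chi$. Let $B_n(x)$ and $E_n(x)$ be the Bernoulli and Euler polynomials, given by $\frac{te^{xt}}{e^t-1}=\sum_{n\ge0}B_n(x)\frac{t^n}{n!}$ and $\frac{2e^{xt}}{e^t+1}=\sum_{n\ge0}E_n(x)\frac{t^n}{n!}$. For $0\le x<1$ and $r\in\mathbb Z$ put $\mathfrak B_n(x+r)=B_n(x)$ if $n\ne1$ or $x\ne0$, $\mathfrak B_1(r)=0$, and $\mathcal E_n(x+r)=(-1)^rE_n(x)$. For a character $\psi$ modulo $k$ put $$\mathfrak B_{m,\psi}(x)=k^{m-1}\sum_{j=0}^{k-1}\bar\psi(j)\,\mathfrak B_m\!\left(\tfrac{j+x}{k}\right)\ (m\ge1),\qquad \mathcal E_{m,\psi}(x)=k^{m}\sum_{j=0}^{k-1}(-1)^j\bar\psi(j)\,\mathcal E_m\!\left(\tfrac{j+x}{k}\right)\ (m\ge0).$$ Let $p\ge1$ be an odd integer and let $\alpha,\beta>0$ be real numbers with $\alpha\beta=(\pi/k)^2$. Then all the infinite series below converge absolutely,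 and $$(-\beta)^{(p-1)/2}\sum_{j=1}^{k-1}\bar\chi(j)\sum_{n=1}^\infty\frac{\chi(n)}{n^p\left(e^{2n\alpha-2\pi ij/k}+1\right)} +2^p\alpha^{(p-1)/2}\chi(-2)\sum_{j=1}^{k-1}\chi(j)\sum_{n=0}^\infty\frac{\bar\chi(2n+1)}{(2n+1)^p\left(e^{(2n+1)\beta-2\pi ij/k}-1\right)}$$ $$=2^{p-2}\frac{k}{p!}\sum_{m=1}^{p}\binom pm\, i^{\,p+1-m}\,\mathcal E_{p-m,\bar\chi}(0)\,\mathfrak B_{m,\chi}(0)\,\alpha^{p-m/2}\,\beta^{(p-1+m)/2}.$$ -/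

import Mathlib

open Complex

/-- The value `E_n(x)` of the Euler polynomial, `n!` times the coefficient of `t^n` in
`2 e^{xt} / (e^t + 1)`. The constant coefficient of `e^t + 1` is `2`, so that the power series
inverse is a genuine one. -/
noncomputable def eulerPoly (n : ℕ) (x : ℝ) : ℝ :=
  (n.factorial : ℝ) * PowerSeries.coeff n
    (2 * PowerSeries.rescale x (PowerSeries.exp ℝ) * (PowerSeries.exp ℝ + 1)⁻¹)

/-- The Bernoulli function: periodic of period one, equal to the Bernoulli polynomial `B_n` on
`[0, 1)`, except that for `n = 1` it vanishes at the integers. -/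
noncomputable def bernoulliFn (n : ℕ) (x : ℝ) : ℝ :=
  if n = 1 ∧ Int.fract x = 0 then 0 else Polynomial.aeval (Int.fract x) (Polynomial.bernoulli n)

/-- The Euler function: equal to `E_n` on `[0, 1)` and antiperiodic of antiperiod one. -/
noncomputable def eulerFn (n : ℕ) (x : ℝ) : ℝ :=
  (-1) ^ ⌊x⌋ * eulerPoly n (Int.fract x)

/-- The generalized Bernoulli function
`k^(m-1) ∑_{0 ≤ j < k} conj χ(j) 𝔅_m((j + x)/k)` of a character `χ` mod `k`. -/
noncomputable def bernoulliCharFn {k : ℕ} (m : ℕ) (χ : DirichletCharacter ℂ k) (x : ℝ) : ℂ :=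
  (k : ℂ) ^ ((m : ℤ) - 1) *
    ∑ j ∈ Finset.range k, star χ (j : ZMod k) * (bernoulliFn m (((j : ℝ) + x) / k) : ℂ)

/-- The character Euler function
`k^m ∑_{0 ≤ j < k} (-1)^j conj χ(j) 𝓔_m((j + x)/k)` of a character `χ` mod `k`, `k` odd. -/
noncomputable def eulerCharFn {k : ℕ} (m : ℕ) (χ : DirichletCharacter ℂ k) (x : ℝ) : ℂ :=
  (k : ℂ) ^ m *
    ∑ j ∈ Finset.range k,
      (-1) ^ j * star χ (j : ZMod k) * (eulerFn m (((j : ℝ) + x) / k) : ℂ)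

/-- The term of index `n ≥ 1` of `∑ χ(n) / (n^p (e^{2nα - 2πij/k} + 1))`. -/
noncomputable def alphaTerm {k : ℕ} (χ : DirichletCharacter ℂ k) (p : ℕ) (α : ℝ) (j n : ℕ) : ℂ :=
  χ (n : ZMod k) / ((n : ℂ) ^ p * (exp (2 * n * α - 2 * Real.pi * I * j / k) + 1))

/-- The term of index `n ≥ 0` of
`∑ conj χ(2n+1) / ((2n+1)^p (e^{(2n+1)β - 2πij/k} - 1))`. -/
noncomputable def betaTerm {k : ℕ} (χ : DirichletCharacter ℂ k) (p : ℕ) (β : ℝ) (j n : ℕ) : ℂ :=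
  star χ ((2 * n + 1 : ℕ) : ZMod k) /
    (((2 * n + 1 : ℕ) : ℂ) ^ p * (exp ((2 * n + 1 : ℕ) * β - 2 * Real.pi * I * j / k) - 1))

/-! The engine is an elementary identity. With x = n + σ, y = m + τ and c = κi, the relation y/c - x
= -(cx - y)/c makes the poles of 1/(x^p (cx - y)) + c^(p-1)/(y^p (y/c - x)) cancel, and a geometric
sum leaves only products x^(-u) y^(-(p+1-u)) (`one_div_pow_mul_sub_add`). Weight this by a(n) b(m),
both periodic modulo k, and sum over n and m. On the left the inner sums of simple poles become
finite sums of cotangents; on the right stand products of bilateral Dirichlet series. This is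
`tsum_cotSum_reciprocity`.

The double series is not absolutely convergent, so everything is first summed over the same finite
blocks of complete periods, where the identity is exact. Weights of sum zero over a period give a
bound on the inner sums that is uniform in the truncation (`exists_norm_poleSum_le`), and dominated
convergence yields the limit.

The theorem is the case a = χ, σ = 0, b(r) = χ⁻¹(2r), τ = k/2, κ = -kα/π. As k is odd, 2(m + k/2)
runs over the odd integers. In exponential form the cotangents produce denominators e^z - 1, and the
shift by k/2 changes these to e^z + 1. The Dirichlet series are Bernoulli and Euler character sums
divided by Gauss sums (`tendsto_dirichletSum_char`, `tendsto_dirichletSum_char_odd`). The Gauss sums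
multiply to χ(-1)k, and the parity of the Bernoulli sums absorbs the remaining sign. -/

/-! ### Cotangent series summed over blocks of periods -/

open Filter Topology in
/-- Symmetric partial fractions of the cotangent. -/
lemma tendsto_sum_Icc_one_div_sub_int {u : ℂ} (hu : u ∈ integerComplement) :
    Tendsto (fun Y : ℕ ↦ ∑ l ∈ Finset.Icc (-(Y : ℤ)) Y, 1 / (u - l)) atTop
      (𝓝 (Real.pi * cot (Real.pi * u))) := by
  have h := (tendsto_logDeriv_euler_cot_sub hu).add_const (1 / u)
  rw [sub_add_cancel] at h
  refine h.congr fun Y ↦ ?_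
  induction Y with
  | zero => simp
  | succ Y ih =>
    rw [Finset.sum_range_succ, add_right_comm, ih]
    push_cast
    rw [Finset.sum_Icc_succ_eq_add_endpoints]
    simp only [cotTerm]
    push_cast
    ring

/-- The integers `j + k l` with `0 ≤ j < k` and `|l| ≤ Y`. -/
noncomputable def periodBlocks (k : ℕ) [NeZero k] (Y : ℕ) : Finset ℤ :=
  (Finset.Icc (-(Y : ℤ)) Y ×ˢ (Finset.univ : Finset (Fin k))).map
    (Int.divModEquiv k).symm.toEmbedding

lemma sum_periodBlocks {M : Type*} [AddCommMonoid M] (k : ℕ) [NeZero k] (Y : ℕ) (f : ℤ → M) :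
    ∑ n ∈ periodBlocks k Y, f n =
      ∑ l ∈ Finset.Icc (-(Y : ℤ)) Y, ∑ j : Fin k, f (l * k + (j : ℕ)) := by
  rw [periodBlocks, Finset.sum_map, Finset.sum_product]
  rfl

open Filter in
lemma tendsto_periodBlocks (k : ℕ) [NeZero k] : Tendsto (periodBlocks k) atTop atTop := by
  refine tendsto_atTop_finset_of_monotone ?_ fun n ↦ ⟨(n / k).natAbs, ?_⟩
  · intro Y Z h
    refine Finset.map_subset_map.2 (Finset.product_subset_product_left ?_)
    exact Finset.Icc_subset_Icc (by simpa using h) (by simpa using h)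
  · rw [periodBlocks, Finset.mem_map]
    refine ⟨Int.divModEquiv k n, ?_, (Int.divModEquiv k).symm_apply_apply n⟩
    simp only [Finset.mem_product, Finset.mem_univ, and_true, Finset.mem_Icc,
      Int.divModEquiv_apply]
    omega

lemma intCast_mul_add_zmod (k : ℕ) (l : ℤ) (j : ℕ) :
    ((l * k + j : ℤ) : ZMod k) = j := by simp

/-- The partial sums of `∑ a(n) / (w - (n + σ))` over blocks of periods. -/
noncomputable def poleSum {k : ℕ} [NeZero k] (a : ZMod k → ℂ) (σ : ℝ) (Y : ℕ) (w : ℂ) : ℂ :=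
  ∑ n ∈ periodBlocks k Y, a (n : ZMod k) / (w - ((n : ℂ) + σ))

/-- The limit of `poleSum`. -/
noncomputable def cotSum {k : ℕ} (a : ZMod k → ℂ) (σ : ℝ) (w : ℂ) : ℂ :=
  ∑ j : Fin k, a ((j : ℕ) : ZMod k) *
    (Real.pi / k * cot (Real.pi * ((w - σ - (j : ℕ)) / k)))

-- Each residue class j contributes 1/k times the symmetric cotangent series at (w - σ - j)/k. Poles
-- are excluded only where the weight is nonzero, so that w = σ = 0 is allowed for a character,
-- which vanishes at the offending residue 0.
open Filter Topology in
lemma tendsto_poleSum {k : ℕ} [NeZero k] (a : ZMod k → ℂ) (σ : ℝ) (w : ℂ)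
    (hw : ∀ j : Fin k, a ((j : ℕ) : ZMod k) ≠ 0 → (w - σ - (j : ℕ)) / k ∈ integerComplement) :
    Tendsto (fun Y ↦ poleSum a σ Y w) atTop (𝓝 (cotSum a σ w)) := by
  have hk : (k : ℂ) ≠ 0 := Nat.cast_ne_zero.2 (NeZero.ne k)
  have h : ∀ Y, poleSum a σ Y w = ∑ j : Fin k, a ((j : ℕ) : ZMod k) *
      (1 / k * ∑ l ∈ Finset.Icc (-(Y : ℤ)) Y, 1 / ((w - σ - (j : ℕ)) / k - l)) := by
    intro Y
    rw [poleSum, sum_periodBlocks, Finset.sum_comm]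
    refine Finset.sum_congr rfl fun j _ ↦ ?_
    rw [Finset.mul_sum, Finset.mul_sum]
    refine Finset.sum_congr rfl fun l _ ↦ ?_
    rw [intCast_mul_add_zmod, one_div_mul_one_div, mul_sub, mul_div_cancel₀ _ hk, mul_one_div]
    push_cast
    congr 1
    ring
  simp only [h, cotSum]
  refine tendsto_finsetSum _ fun j _ ↦ ?_
  by_cases hj : a ((j : ℕ) : ZMod k) = 0
  · simp [hj]
  · refine Tendsto.const_mul _ ?_
    rw [show (Real.pi / k * cot (Real.pi * ((w - σ - (j : ℕ)) / k)) : ℂ) =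
      1 / k * (Real.pi * cot (Real.pi * ((w - σ - (j : ℕ)) / k))) by ring]
    exact (tendsto_sum_Icc_one_div_sub_int (hw j hj)).const_mul _

/-! ### Uniform bounds on the imaginary axis and dominated convergence -/

lemma imaginary_sub_real_div_mem_integerComplement {θ : ℝ} (hθ : θ ≠ 0) (x : ℝ) {k : ℕ}
    (hk : k ≠ 0) : ((θ * I - x) / k : ℂ) ∈ integerComplement := by
  rintro ⟨n, hn⟩
  have := congrArg im hn
  have hk' : (k : ℝ) ≠ 0 := by exact_mod_cast hk
  rw [Complex.div_natCast_im] at this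
  simp only [intCast_im, sub_im, im_ofReal_mul, ofReal_im, I_im, mul_one,
    sub_zero] at this
  exact div_ne_zero hθ hk' this.symm

lemma summable_rpow_sqrt_sq_add_int (c σ : ℝ) {k : ℕ} (hk : k ≠ 0) :
    Summable fun l : ℤ ↦ (√(c ^ 2 + (l * k + σ) ^ 2) ^ (3 / 2 : ℝ))⁻¹ := by
  have hk' : (0 : ℝ) < k := by positivity
  have h := ((Real.summable_one_div_int_add_rpow (σ / k) (3 / 2)).2 (by norm_num)).mul_left
    ((k : ℝ) ^ (3 / 2 : ℝ))⁻¹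
  refine h.of_norm_bounded_eventually ?_
  -- The comparison with |l + σ/k|^(-3/2) can fail only where l + σ/k = 0, since the comparison term
  -- is then 1/0 = 0.
  have hfin : {l : ℤ | (l : ℝ) = -(σ / k)}.Finite :=
    Set.Subsingleton.finite fun l hl m hm ↦ by
      have : (l : ℝ) = m := hl.trans hm.symm
      exact_mod_cast this
  refine hfin.subset fun l hl ↦ ?_
  by_contra hne
  apply hl
  have h0 : 0 < |l + σ / k| := abs_pos.2 fun h ↦ hne (by simp only [Set.mem_ofPred_eq]; linarith)
  rw [Set.mem_ofPred_eq]
  rw [Real.norm_of_nonneg (by positivity), one_div, ← mul_inv, ← Real.mul_rpow hk'.le h0.le]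
  refine inv_anti₀ (by positivity) (Real.rpow_le_rpow (by positivity) ?_ (by norm_num))
  refine Real.le_sqrt_of_sq_le ?_
  rw [mul_pow, sq_abs, ← mul_pow, mul_add, mul_div_cancel₀ _ hk'.ne', mul_comm]
  nlinarith [sq_nonneg c]

/-- Subtracting (∑ a(j))/z = 0 replaces 1/(z - j) by j/((z - j)z), which decays quadratically. The
lower bound on the imaginary part makes |z| at most a constant times |z - j|. -/
lemma norm_block_le {k : ℕ} [NeZero k] {a : ZMod k → ℂ} (ha : ∑ j : Fin k, a ((j : ℕ) : ZMod k) = 0)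
    {θ₀ : ℝ} (hθ₀ : 0 < θ₀) {z : ℂ} (hz : θ₀ ≤ |z.im|) :
    ‖∑ j : Fin k, a ((j : ℕ) : ZMod k) / (z - (j : ℕ))‖ ≤
      (∑ j : Fin k, ‖a ((j : ℕ) : ZMod k)‖) * (k * (1 + k / θ₀)) / ‖z‖ ^ 2 := by
  have him : ∀ x : ℝ, θ₀ ≤ ‖z - x‖ := fun x ↦ hz.trans (by simpa using abs_im_le_norm (z - x))
  have hz0 : z ≠ 0 := by rintro rfl; simp at hz; linarith
  have h : ∑ j : Fin k, a ((j : ℕ) : ZMod k) / (z - (j : ℕ)) =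
      ∑ j : Fin k, a ((j : ℕ) : ZMod k) * ((j : ℕ) / ((z - (j : ℕ)) * z)) := by
    rw [← sub_zero (∑ j : Fin k, a ((j : ℕ) : ZMod k) / (z - (j : ℕ))), ← zero_div z, ← ha,
      Finset.sum_div, ← Finset.sum_sub_distrib]
    refine Finset.sum_congr rfl fun j _ ↦ ?_
    have : z - (j : ℕ) ≠ 0 := norm_pos_iff.1 (hθ₀.trans_le (him (j : ℕ)))
    field_simp
    ring
  rw [h, Finset.sum_mul, Finset.sum_div]
  refine norm_sum_le_of_le _ fun j _ ↦ ?_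
  rw [norm_mul, mul_div_assoc]
  refine mul_le_mul_of_nonneg_left ?_ (norm_nonneg _)
  have hj : ((j : ℕ) : ℝ) ≤ k := by exact_mod_cast j.2.le
  have h1 := him (j : ℕ)
  rw [ofReal_natCast] at h1
  have hzz : ‖z‖ ≤ (1 + k / θ₀) * ‖z - (j : ℕ)‖ := by
    have h2 : ‖z‖ ≤ ‖z - (j : ℕ)‖ + j := by
      have := norm_add_le (z - (j : ℕ)) ((j : ℕ) : ℂ)
      rwa [sub_add_cancel, norm_natCast] at this
    have h3 : (j : ℝ) ≤ k / θ₀ * ‖z - (j : ℕ)‖ :=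
      calc (j : ℝ) ≤ k := hj
        _ = k / θ₀ * θ₀ := by field_simp
        _ ≤ _ := by gcongr
    linarith
  have hzp : 0 < ‖z‖ := norm_pos_iff.2 hz0
  have hp : 0 < ‖z - (j : ℕ)‖ := hθ₀.trans_le h1
  rw [norm_div, norm_mul, norm_natCast, div_le_div_iff₀ (by positivity) (by positivity)]
  calc (j : ℝ) * ‖z‖ ^ 2 = j * ‖z‖ * ‖z‖ := by ring
    _ ≤ k * ((1 + k / θ₀) * ‖z - (j : ℕ)‖) * ‖z‖ := by gcongr
    _ = _ := by ring

/-- The quadratic decay of a block is split as 2 = 1/2 + 3/2: the exponent 3/2 pays for the sum over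
blocks, uniformly in `Y`, and the exponent 1/2 is kept as decay in θ. That surplus is what makes the
outer sum converge even for p = 1. -/
lemma exists_norm_poleSum_le {k : ℕ} [NeZero k] {a : ZMod k → ℂ}
    (ha : ∑ j : Fin k, a ((j : ℕ) : ZMod k) = 0) (σ : ℝ) {θ₀ : ℝ} (hθ₀ : 0 < θ₀) :
    ∃ C : ℝ, 0 ≤ C ∧ ∀ (Y : ℕ) (θ : ℝ), θ₀ ≤ |θ| →
      ‖poleSum a σ Y (θ * I)‖ ≤ C * (|θ| ^ (1 / 2 : ℝ))⁻¹ := by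
  set A := (∑ j : Fin k, ‖a ((j : ℕ) : ZMod k)‖) * (k * (1 + k / θ₀)) with hA
  have hA0 : 0 ≤ A := by positivity
  have hs := summable_rpow_sqrt_sq_add_int θ₀ σ (NeZero.ne k)
  refine ⟨A * ∑' l : ℤ, (√(θ₀ ^ 2 + (l * k + σ) ^ 2) ^ (3 / 2 : ℝ))⁻¹,
    mul_nonneg hA0 (tsum_nonneg fun l ↦ by positivity), fun Y θ hθ ↦ ?_⟩
  have key : ∀ l : ℤ, ‖∑ j : Fin k, a (((l * k + (j : ℕ) : ℤ)) : ZMod k) /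
      (θ * I - (((l * k + (j : ℕ) : ℤ) : ℂ) + σ))‖ ≤
      A * (|θ| ^ (1 / 2 : ℝ))⁻¹ * (√(θ₀ ^ 2 + (l * k + σ) ^ 2) ^ (3 / 2 : ℝ))⁻¹ := by
    intro l
    have hz : ((θ * I - ((l * k + σ : ℝ) : ℂ)) : ℂ).im = θ := by
      rw [Complex.sub_im, ofReal_im]; simp
    have hz' : ((θ * I - ((l * k + σ : ℝ) : ℂ)) : ℂ).re = -(l * k + σ) := by
      rw [Complex.sub_re, ofReal_re]; simp
    have := norm_block_le ha hθ₀ (z := θ * I - ((l * k + σ : ℝ) : ℂ)) (by rwa [hz])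
    have e : ∑ j : Fin k, a (((l * k + (j : ℕ) : ℤ)) : ZMod k) /
        (θ * I - (((l * k + (j : ℕ) : ℤ) : ℂ) + σ)) =
        ∑ j : Fin k, a ((j : ℕ) : ZMod k) / (θ * I - ((l * k + σ : ℝ) : ℂ) - (j : ℕ)) := by
      refine Finset.sum_congr rfl fun j _ ↦ ?_
      rw [intCast_mul_add_zmod]
      push_cast
      congr 1
      ring
    rw [e]
    refine this.trans ?_
    rw [div_eq_mul_inv, mul_assoc A, ← mul_inv]
    have hθp : 0 < |θ| := hθ₀.trans_le hθ
    have hsq : θ₀ ^ 2 ≤ θ ^ 2 := by rw [← sq_abs θ]; gcongr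
    set N := ‖(θ * I - ((l * k + σ : ℝ) : ℂ))‖ with hN
    have hNe : N = √(θ ^ 2 + (l * k + σ) ^ 2) := by
      rw [hN, Complex.norm_eq_sqrt_sq_add_sq, hz, hz', neg_sq, add_comm]
    have h1 : |θ| ≤ N := by
      rw [hNe]; exact Real.abs_le_sqrt (by nlinarith [sq_nonneg (l * k + σ)])
    have h2 : √(θ₀ ^ 2 + (l * k + σ) ^ 2) ≤ N := by
      rw [hNe]; exact Real.sqrt_le_sqrt (by linarith)
    have h3 : 0 < √(θ₀ ^ 2 + (l * k + σ) ^ 2) := by positivity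
    have hNp : 0 < N := hθp.trans_le h1
    refine mul_le_mul_of_nonneg_left (inv_anti₀ (by positivity) ?_) hA0
    calc _ ≤ N ^ (1 / 2 : ℝ) * N ^ (3 / 2 : ℝ) := by gcongr
      _ = N ^ 2 := by rw [← Real.rpow_add hNp, ← Real.rpow_natCast]; norm_num
  rw [poleSum, sum_periodBlocks]
  refine (norm_sum_le_of_le _ fun l _ ↦ key l).trans ?_
  rw [← Finset.mul_sum, mul_right_comm A]
  gcongr
  exact hs.sum_le_tsum _ fun l _ ↦ by positivity

-- The uniform bound dominates every term by a multiple of |n + σ|^(-3/2), so the outer range and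
-- the inner truncation can go to infinity together.
open Filter Topology in
lemma tendsto_sum_div_pow_mul_poleSum {k : ℕ} [NeZero k] {a b : ZMod k → ℂ} {σ : ℝ} (τ : ℝ)
    (ha : ∀ n : ℤ, a (n : ZMod k) ≠ 0 → 1 / 2 ≤ |(n : ℝ) + σ|)
    (hb : ∑ j : Fin k, b ((j : ℕ) : ZMod k) = 0) {κ : ℝ} (hκ : κ ≠ 0) {p : ℕ} (hp : p ≠ 0) :
    Summable (fun n : ℤ ↦ a (n : ZMod k) / ((n : ℂ) + σ) ^ p *
      cotSum b τ ((κ * (n + σ) : ℝ) * I)) ∧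
    Tendsto (fun Y ↦ ∑ n ∈ periodBlocks k Y, a (n : ZMod k) / ((n : ℂ) + σ) ^ p *
      poleSum b τ Y ((κ * (n + σ) : ℝ) * I)) atTop
      (𝓝 (∑' n : ℤ, a (n : ZMod k) / ((n : ℂ) + σ) ^ p *
        cotSum b τ ((κ * (n + σ) : ℝ) * I))) := by
  have hκ' : 0 < |κ| := abs_pos.2 hκ
  obtain ⟨C, hC, hbd⟩ := exists_norm_poleSum_le hb τ (θ₀ := |κ| * (1 / 2)) (by positivity)
  set A := ∑ r : ZMod k, ‖a r‖ with hA
  have hA0 : 0 ≤ A := by positivity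
  have hlim : ∀ n : ℤ, Tendsto (fun Y ↦ a (n : ZMod k) / ((n : ℂ) + σ) ^ p *
      poleSum b τ Y ((κ * (n + σ) : ℝ) * I)) atTop
      (𝓝 (a (n : ZMod k) / ((n : ℂ) + σ) ^ p * cotSum b τ ((κ * (n + σ) : ℝ) * I))) := by
    intro n
    by_cases hn : a (n : ZMod k) = 0
    · simp [hn]
    · have h0 : (n : ℝ) + σ ≠ 0 := by
        intro h
        have := ha n hn
        rw [h, abs_zero] at this
        norm_num at this
      refine (tendsto_poleSum b τ _ fun j _ ↦ ?_).const_mul _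
      have := imaginary_sub_real_div_mem_integerComplement (mul_ne_zero hκ h0) (τ + (j : ℕ))
        (NeZero.ne k)
      convert this using 2
      push_cast
      ring
  have hle : ∀ (Y : ℕ) (n : ℤ), ‖a (n : ZMod k) / ((n : ℂ) + σ) ^ p *
      poleSum b τ Y ((κ * (n + σ) : ℝ) * I)‖ ≤
      A * 2 ^ (p - 1) * C * (|κ| ^ (1 / 2 : ℝ))⁻¹ * (1 / |(n : ℝ) + σ| ^ (3 / 2 : ℝ)) := by
    intro Y n
    by_cases hn : a (n : ZMod k) = 0
    · simp only [hn, zero_div, zero_mul, norm_zero]; positivity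
    have hx := ha n hn
    set x := (n : ℝ) + σ with hxdef
    have hxp : 0 < |x| := lt_of_lt_of_le (by norm_num) hx
    have h1 := hbd Y (κ * x) (by rw [abs_mul]; gcongr)
    have h2 : ‖a (n : ZMod k) / ((n : ℂ) + σ) ^ p‖ ≤ A * 2 ^ (p - 1) * |x|⁻¹ := by
      have e : (n : ℂ) + σ = (x : ℂ) := by rw [hxdef]; push_cast; rfl
      rw [e, norm_div, norm_pow, norm_real, Real.norm_eq_abs, div_eq_mul_inv, mul_assoc]
      refine mul_le_mul (Finset.single_le_sum (f := fun r ↦ ‖a r‖)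
        (fun _ _ ↦ norm_nonneg _) (Finset.mem_univ _)) ?_ (by positivity) hA0
      obtain ⟨q, rfl⟩ := Nat.exists_eq_succ_of_ne_zero hp
      rw [Nat.succ_sub_one, pow_succ, mul_inv, ← inv_pow]
      gcongr
      rw [inv_le_comm₀ hxp (by norm_num)]
      linarith
    rw [norm_mul]
    refine (mul_le_mul h2 h1 (norm_nonneg _) (by positivity)).trans (le_of_eq ?_)
    rw [abs_mul, Real.mul_rpow hκ'.le hxp.le,
      show (3 / 2 : ℝ) = 1 + 1 / 2 by norm_num, Real.rpow_add hxp, Real.rpow_one]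
    field_simp
  have hsum := ((Real.summable_one_div_int_add_rpow σ (3 / 2)).2 (by norm_num)).mul_left
    (A * 2 ^ (p - 1) * C * (|κ| ^ (1 / 2 : ℝ))⁻¹)
  refine ⟨hsum.of_norm_bounded fun n ↦ le_of_tendsto (hlim n).norm (.of_forall fun Y ↦ hle Y n), ?_⟩
  -- Extending by zero outside the block turns the growing finite sums into series over all of ℤ.
  have h := tendsto_tsum_of_dominated_convergence (𝓕 := atTop)
    (f := fun Y n ↦ if n ∈ periodBlocks k Y then a (n : ZMod k) / ((n : ℂ) + σ) ^ p *
      poleSum b τ Y ((κ * (n + σ) : ℝ) * I) else 0) hsum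
    (fun n ↦ (hlim n).congr' ?_) (.of_forall fun Y n ↦ ?_)
  · refine h.congr fun Y ↦ ?_
    rw [tsum_eq_sum (s := periodBlocks k Y) fun n hn ↦ if_neg hn]
    exact Finset.sum_congr rfl fun n hn ↦ if_pos hn
  · filter_upwards [(tendsto_periodBlocks k).eventually (eventually_ge_atTop {n})] with Y hY
    rw [if_pos (hY (Finset.mem_singleton_self n))]
  · split_ifs
    · exact hle Y n
    · rw [norm_zero]; positivity

/-! ### The reciprocity law -/

/-- The partial sums of `∑ a(n) / (n + σ) ^ u` over blocks of periods. -/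
noncomputable def dirichletSum {k : ℕ} [NeZero k] (a : ZMod k → ℂ) (σ : ℝ) (u Y : ℕ) : ℂ :=
  ∑ n ∈ periodBlocks k Y, a (n : ZMod k) / ((n : ℂ) + σ) ^ u

/-- Over a common denominator the left side is (y^p - (cx)^p)/(x^p y^p (cx - y)), and the geometric
sum divides out cx - y. -/
lemma one_div_pow_mul_sub_add {p : ℕ} (hp : p ≠ 0) {c x y : ℂ} (hc : c ≠ 0) (hx : x ≠ 0) (hy : y ≠ 0)
    (h : c * x - y ≠ 0) :
    1 / x ^ p * (1 / (c * x - y)) + c ^ (p - 1) * (1 / y ^ p * (1 / (y / c - x))) =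
      -∑ u ∈ Finset.Icc 1 p, c ^ (p - u) * (1 / x ^ u * (1 / y ^ (p + 1 - u))) := by
  have hs : ∑ u ∈ Finset.Icc 1 p, c ^ (p - u) * (1 / x ^ u * (1 / y ^ (p + 1 - u))) =
      (∑ i ∈ Finset.range p, (c * x) ^ i * y ^ (p - 1 - i)) / (x ^ p * y ^ p) := by
    rw [Finset.sum_div]
    refine Finset.sum_bij' (fun u _ ↦ p - u) (fun i _ ↦ p - i) ?_ ?_ ?_ ?_ ?_
    · intro u hu; simp only [Finset.mem_Icc, Finset.mem_range] at *; omega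
    · intro u hu; simp only [Finset.mem_Icc, Finset.mem_range] at *; omega
    · intro u hu; simp only [Finset.mem_Icc] at *; omega
    · intro u hu; simp only [Finset.mem_range] at *; omega
    · intro u hu
      rw [Finset.mem_Icc] at hu
      obtain ⟨v, rfl⟩ := Nat.exists_eq_add_of_le hu.2
      obtain ⟨w, rfl⟩ := Nat.exists_eq_add_of_le hu.1
      have e1 : 1 + w + v - (1 + w) = v := by omega
      have e2 : 1 + w + v + 1 - (1 + w) = v + 1 := by omega
      have e3 : 1 + w + v - 1 - v = w := by omega
      rw [e1, e2, e3, mul_pow]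
      field_simp
      ring
  have hg := geom_sum₂_mul (c * x) y p
  rw [hs, eq_div_of_mul_eq h hg]
  have h' : y / c - x = -(c * x - y) / c := by field_simp; ring
  obtain ⟨q, rfl⟩ := Nat.exists_eq_succ_of_ne_zero hp
  rw [h', Nat.succ_eq_add_one, Nat.add_sub_cancel, mul_pow]
  field_simp
  ring

/-- Both double sums run over the same finite square of blocks, so the order of summation is free
and the identity holds termwise. -/
lemma dirichletSum_reciprocity {k : ℕ} [NeZero k] {a b : ZMod k → ℂ} {σ τ : ℝ}
    (ha : ∀ n : ℤ, a (n : ZMod k) ≠ 0 → 1 / 2 ≤ |(n : ℝ) + σ|)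
    (hb : ∀ n : ℤ, b (n : ZMod k) ≠ 0 → 1 / 2 ≤ |(n : ℝ) + τ|)
    {κ : ℝ} (hκ : κ ≠ 0) {p : ℕ} (hp : p ≠ 0) (Y : ℕ) :
    ∑ n ∈ periodBlocks k Y, a (n : ZMod k) / ((n : ℂ) + σ) ^ p *
        poleSum b τ Y ((κ * (n + σ) : ℝ) * I) +
      (κ * I) ^ (p - 1) * ∑ n ∈ periodBlocks k Y, b (n : ZMod k) / ((n : ℂ) + τ) ^ p *
        poleSum a σ Y ((-κ⁻¹ * (n + τ) : ℝ) * I) =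
    -∑ u ∈ Finset.Icc 1 p, (κ * I) ^ (p - u) *
      (dirichletSum a σ u Y * dirichletSum b τ (p + 1 - u) Y) := by
  have hκ' : (κ : ℂ) ≠ 0 := ofReal_ne_zero.2 hκ
  have hR : ∑ u ∈ Finset.Icc 1 p, (κ * I) ^ (p - u) *
      (dirichletSum a σ u Y * dirichletSum b τ (p + 1 - u) Y) =
      ∑ n ∈ periodBlocks k Y, ∑ m ∈ periodBlocks k Y, ∑ u ∈ Finset.Icc 1 p, (κ * I) ^ (p - u) *
        (a (n : ZMod k) / ((n : ℂ) + σ) ^ u * (b (m : ZMod k) / ((m : ℂ) + τ) ^ (p + 1 - u))) := by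
    simp only [dirichletSum, Finset.sum_mul_sum]
    simp only [Finset.mul_sum]
    rw [Finset.sum_comm]
    exact Finset.sum_congr rfl fun n _ ↦ Finset.sum_comm
  rw [hR]
  simp only [poleSum, Finset.mul_sum]
  rw [Finset.sum_comm (γ := ℤ) (f := fun n m : ℤ ↦ (κ * I) ^ (p - 1) * _),
    ← Finset.sum_add_distrib, ← Finset.sum_neg_distrib]
  refine Finset.sum_congr rfl fun n _ ↦ ?_
  rw [← Finset.sum_add_distrib, ← Finset.sum_neg_distrib]
  refine Finset.sum_congr rfl fun m _ ↦ ?_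
  by_cases han : a (n : ZMod k) = 0
  · simp [han]
  by_cases hbm : b (m : ZMod k) = 0
  · simp [hbm]
  have ne_of_half : ∀ x : ℝ, 1 / 2 ≤ |x| → x ≠ 0 := by
    rintro x hx rfl
    rw [abs_zero] at hx
    norm_num at hx
  set x : ℝ := n + σ with hx
  set y : ℝ := m + τ with hy
  have hx0 : x ≠ 0 := ne_of_half _ (ha n han)
  have hy0 : y ≠ 0 := ne_of_half _ (hb m hbm)
  have ex : (n : ℂ) + σ = x := by rw [hx]; push_cast; rfl
  have ey : (m : ℂ) + τ = y := by rw [hy]; push_cast; rfl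
  have key := one_div_pow_mul_sub_add hp (c := κ * I) (x := x) (y := y)
    -- The difference cx - y has imaginary part κx, which is nonzero.
    (mul_ne_zero hκ' I_ne_zero) (ofReal_ne_zero.2 hx0) (ofReal_ne_zero.2 hy0) (fun h ↦ by
      have := congrArg im h
      simp [hκ, hx0] at this)
  have e1 : ((κ * x : ℝ) : ℂ) * I = κ * I * x := by push_cast; ring
  have e2 : ((-κ⁻¹ * y : ℝ) : ℂ) * I = y / (κ * I) := by
    push_cast
    field_simp
    rw [I_sq]; ring
  rw [ex, ey, e1, e2]
  calc _ = a (n : ZMod k) * b (m : ZMod k) * (1 / (x : ℂ) ^ p * (1 / (κ * I * x - y)) +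
        (κ * I) ^ (p - 1) * (1 / (y : ℂ) ^ p * (1 / (y / (κ * I) - x)))) := by ring
    _ = _ := by
      rw [key, mul_neg, Finset.mul_sum]
      congr 1
      refine Finset.sum_congr rfl fun u _ ↦ ?_
      ring

open Filter Topology in
/-- The reciprocity law between two lattice sums attached to periodic functions. -/
lemma tsum_cotSum_reciprocity {k : ℕ} [NeZero k] {a b : ZMod k → ℂ} {σ τ : ℝ}
    (ha : ∀ n : ℤ, a (n : ZMod k) ≠ 0 → 1 / 2 ≤ |(n : ℝ) + σ|)
    (hb : ∀ n : ℤ, b (n : ZMod k) ≠ 0 → 1 / 2 ≤ |(n : ℝ) + τ|)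
    (ha0 : ∑ j : Fin k, a ((j : ℕ) : ZMod k) = 0) (hb0 : ∑ j : Fin k, b ((j : ℕ) : ZMod k) = 0)
    {κ : ℝ} (hκ : κ ≠ 0) {p : ℕ} (hp : p ≠ 0) {A B : ℕ → ℂ}
    (hA : ∀ u, 1 ≤ u → Tendsto (dirichletSum a σ u) atTop (𝓝 (A u)))
    (hB : ∀ u, 1 ≤ u → Tendsto (dirichletSum b τ u) atTop (𝓝 (B u))) :
    ∑' n : ℤ, a (n : ZMod k) / ((n : ℂ) + σ) ^ p * cotSum b τ ((κ * (n + σ) : ℝ) * I) +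
      (κ * I) ^ (p - 1) * ∑' n : ℤ, b (n : ZMod k) / ((n : ℂ) + τ) ^ p *
        cotSum a σ ((-κ⁻¹ * (n + τ) : ℝ) * I) =
    -∑ u ∈ Finset.Icc 1 p, (κ * I) ^ (p - u) * (A u * B (p + 1 - u)) := by
  have h1 := (tendsto_sum_div_pow_mul_poleSum τ ha hb0 hκ hp).2
  have h2 := (tendsto_sum_div_pow_mul_poleSum σ hb ha0 (neg_ne_zero.2 (inv_ne_zero hκ)) hp).2
  refine tendsto_nhds_unique (h1.add (h2.const_mul ((κ * I : ℂ) ^ (p - 1)))) ?_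
  simp only [dirichletSum_reciprocity ha hb hκ hp]
  refine (tendsto_finsetSum _ fun u hu ↦ ?_).neg
  rw [Finset.mem_Icc] at hu
  exact ((hA u hu.1).mul (hB _ (by omega))).const_mul _

/-! ### Gauss sums and cotangents in exponential form -/

lemma sum_zmod_eq_sum_range {M : Type*} [AddCommMonoid M] {k : ℕ} [NeZero k] (f : ZMod k → M) :
    ∑ r : ZMod k, f r = ∑ j ∈ Finset.range k, f (j : ZMod k) := by
  rw [Finset.sum_range fun j ↦ f (j : ZMod k)]
  obtain ⟨n, rfl⟩ := Nat.exists_eq_succ_of_ne_zero (NeZero.ne k)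
  exact Finset.sum_congr rfl fun j _ ↦ by rw [← Fin.cast_val_eq_self j]; simp; rfl

lemma DirichletCharacter.IsPrimitive.inv {k : ℕ} {χ : DirichletCharacter ℂ k}
    (h : χ.IsPrimitive) : χ⁻¹.IsPrimitive := by
  rw [DirichletCharacter.IsPrimitive, DirichletCharacter.conductor_inv, h]

lemma sum_dirichletCharacter_mul_exp {k : ℕ} [NeZero k] {ψ : DirichletCharacter ℂ k}
    (h : ψ.IsPrimitive) (n : ℤ) :
    ∑ j ∈ Finset.range k, ψ (j : ZMod k) * exp (2 * Real.pi * I * (j * n) / k) =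
      ψ⁻¹ (n : ZMod k) * gaussSum ψ ZMod.stdAddChar := by
  rw [← gaussSum_mulShift_of_isPrimitive _ h, gaussSum, sum_zmod_eq_sum_range]
  refine Finset.sum_congr rfl fun j _ ↦ ?_
  rw [AddChar.mulShift_apply, show (n : ZMod k) * (j : ZMod k) = ((j * n : ℤ) : ZMod k) by
    push_cast; ring, ZMod.stdAddChar_coe]
  push_cast
  rfl

/-- The discrete Fourier transform sends a primitive χ to a multiple of χ⁻¹, the factor being a
Gauss sum up to sign. Applying it twice is k times reflection, and evaluation at -1 compares the
constants. -/
lemma gaussSum_mul_gaussSum_inv {k : ℕ} [NeZero k] {χ : DirichletCharacter ℂ k}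
    (h : χ.IsPrimitive) :
    gaussSum χ ZMod.stdAddChar * gaussSum χ⁻¹ ZMod.stdAddChar = χ (-1) * k := by
  have h1 := congrFun (ZMod.dft_dft (⇑χ)) (-1)
  have h2 : ZMod.dft (⇑χ) = fun r ↦ (χ⁻¹ (-1) * gaussSum χ ZMod.stdAddChar) * χ⁻¹ r := by
    funext r
    rw [h.fourierTransform_eq_inv_mul_gaussSum, ← neg_one_mul, map_mul]
    ring
  rw [h2, ZMod.dft_const_mul] at h1
  simp only [neg_neg, map_one, smul_eq_mul, mul_one,
    h.inv.fourierTransform_eq_inv_mul_gaussSum, inv_inv] at h1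
  have h3 : χ⁻¹ (-1) * χ (-1) = 1 := by
    rw [← MulChar.mul_apply, inv_mul_cancel, MulChar.one_apply isUnit_one.neg]
  linear_combination χ (-1) * h1 - gaussSum χ ZMod.stdAddChar * gaussSum χ⁻¹ ZMod.stdAddChar * h3

lemma gaussSum_ne_zero_of_isPrimitive {k : ℕ} [NeZero k] {χ : DirichletCharacter ℂ k}
    (h : χ.IsPrimitive) : gaussSum χ ZMod.stdAddChar ≠ 0 := by
  intro h0
  have h1 := gaussSum_mul_gaussSum_inv h
  rw [h0, zero_mul] at h1
  have h2 : χ (-1) ≠ 0 := ((isUnit_one (M := ZMod k)).neg.map χ).ne_zero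
  exact mul_ne_zero h2 (Nat.cast_ne_zero.2 (NeZero.ne k)) h1.symm

/-- A sum of cotangents with weights of sum zero, in exponential form. -/
lemma cotSum_eq_sum_exp {k : ℕ} [NeZero k] {a : ZMod k → ℂ}
    (ha : ∑ j ∈ Finset.range k, a (j : ZMod k) = 0) (σ : ℝ) (w : ℂ)
    (hw : ∀ j ∈ Finset.range k, a (j : ZMod k) ≠ 0 →
      exp (2 * Real.pi * I * ((w - σ - j) / k)) ≠ 1) :
    cotSum a σ w = 2 * Real.pi * I / k * ∑ j ∈ Finset.range k,
      a (j : ZMod k) / (exp (2 * Real.pi * I * ((w - σ - j) / k)) - 1) := by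
  have h : cotSum a σ w = ∑ j ∈ Finset.range k, a (j : ZMod k) *
      (Real.pi / k * cot (Real.pi * ((w - σ - j) / k))) := (Finset.sum_range fun j ↦
        a (j : ZMod k) * (Real.pi / k * cot (Real.pi * ((w - σ - j) / k)))).symm
  -- With E the exponential, π cot = πi + 2πi/(E - 1); the constant πi disappears because the
  -- weights sum to zero.
  rw [h, ← add_zero (2 * Real.pi * I / k * _), ← mul_zero (Real.pi * I / k), ← ha,
    Finset.mul_sum, Finset.mul_sum, ← Finset.sum_add_distrib]
  refine Finset.sum_congr rfl fun j hj ↦ ?_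
  by_cases h0 : a (j : ZMod k) = 0
  · simp [h0]
  rw [Complex.cot_pi_eq_exp_ratio]
  have h1 := sub_ne_zero.2 (hw j hj h0)
  have hk : (k : ℂ) ≠ 0 := Nat.cast_ne_zero.2 (NeZero.ne k)
  generalize exp (2 * Real.pi * I * ((w - σ - j) / k)) = E at h1
  have h2 : 1 - E ≠ 0 := fun h ↦ h1 (by linear_combination -h)
  field_simp
  ring_nf
  rw [I_sq]
  ring

/-! ### Values of the bilateral Dirichlet series -/

/-- The Fourier expansions used for higher exponents converge absolutely and do not cover exponent
one; there the value is read off from the cotangent sum at w = 0. -/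
lemma dirichletSum_one {k : ℕ} [NeZero k] (a : ZMod k → ℂ) (σ : ℝ) (Y : ℕ) :
    dirichletSum a σ 1 Y = -poleSum a σ Y 0 := by
  rw [dirichletSum, poleSum, ← Finset.sum_neg_distrib]
  refine Finset.sum_congr rfl fun n _ ↦ ?_
  rw [zero_sub, div_neg, neg_neg, pow_one]

lemma exp_two_pi_I_mul_ne_one_of_mem {u : ℂ} (hu : u ∈ integerComplement) :
    exp (2 * Real.pi * I * u) ≠ 1 := by
  intro h
  obtain ⟨n, hn⟩ := Complex.exp_eq_one_iff.1 h
  exact hu ⟨n, (mul_left_cancel₀ two_pi_I_ne_zero (hn.trans (mul_comm _ _))).symm⟩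

lemma sum_range_pow_of_isPrimitiveRoot {k : ℕ} {ζ : ℂ} (hζ : IsPrimitiveRoot ζ k) {s : ℕ}
    (hs : ¬ k ∣ s) : ∑ j ∈ Finset.range k, ζ ^ (j * s) = 0 := by
  have h1 : ζ ^ s - 1 ≠ 0 := sub_ne_zero.2 fun h ↦ hs (hζ.dvd_of_pow_eq_one s h)
  have h2 := mul_geom_sum (ζ ^ s) k
  rw [← pow_mul, mul_comm s k, pow_mul, hζ.pow_eq_one, one_pow, sub_self] at h2
  have h3 := (mul_eq_zero.1 h2).resolve_left h1
  simpa only [← pow_mul, mul_comm s] using h3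

/-- `∑_{0 < j < k} ζ^{js} / (ζ^{-j} - 1)` is affine in `s` for `0 ≤ s < k`. -/
lemma sum_pow_div_inv_pow_sub_one {k : ℕ} (hk : 0 < k) {ζ : ℂ} (hζ : IsPrimitiveRoot ζ k) {s : ℕ}
    (hs : s < k) :
    ∑ j ∈ Finset.Ico 1 k, ζ ^ (j * s) / ((ζ ^ j)⁻¹ - 1) =
      s + ∑ j ∈ Finset.Ico 1 k, 1 / ((ζ ^ j)⁻¹ - 1) := by
  have hζ0 : ζ ≠ 0 := hζ.ne_zero hk.ne'
  induction s with
  | zero => simp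
  | succ s ih =>
    have h := sum_range_pow_of_isPrimitiveRoot hζ (s := s + 1) (Nat.not_dvd_of_pos_of_lt (by omega) hs)
    rw [Finset.range_eq_Ico, Finset.sum_eq_sum_Ico_succ_bot hk, zero_mul, pow_zero] at h
    -- Raising s by one subtracts ∑ ζ^(j(s+1)) over 0 < j < k, which is -1; hence slope 1.
    have h' : ∑ j ∈ Finset.Ico 1 k, ζ ^ (j * (s + 1)) / ((ζ ^ j)⁻¹ - 1) =
        ∑ j ∈ Finset.Ico 1 k, ζ ^ (j * s) / ((ζ ^ j)⁻¹ - 1) -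
          ∑ j ∈ Finset.Ico 1 k, ζ ^ (j * (s + 1)) := by
      rw [← Finset.sum_sub_distrib]
      refine Finset.sum_congr rfl fun j hj ↦ ?_
      rw [Finset.mem_Ico] at hj
      have hj1 : ζ ^ j ≠ 1 := hζ.pow_ne_one_of_pos_of_lt (by omega) hj.2
      have hj0 : ζ ^ j ≠ 0 := pow_ne_zero _ hζ0
      have h1 : (ζ ^ j)⁻¹ - 1 ≠ 0 := sub_ne_zero.2 fun h ↦ hj1 (inv_eq_one.1 h)
      have h2 : 1 - ζ ^ j ≠ 0 := sub_ne_zero.2 hj1.symm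
      rw [eq_sub_iff_add_eq, div_add' _ _ _ h1, mul_add, mul_one, pow_add]
      congr 1
      field_simp
      ring
    rw [h', ih (by omega), ← neg_eq_of_add_eq_zero_right h]
    push_cast
    ring

/-- `∑_{0 ≤ j < k} ζ^{js} / (ζ^{-j} + 1) = (-1)^s k / 2` for `0 ≤ s < k`, `k` odd. -/
lemma sum_pow_div_inv_pow_add_one {k : ℕ} (hk : Odd k) {ζ : ℂ} (hζ : IsPrimitiveRoot ζ k) {s : ℕ}
    (hs : s < k) :
    ∑ j ∈ Finset.range k, ζ ^ (j * s) / ((ζ ^ j)⁻¹ + 1) = (-1) ^ s * (k / 2) := by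
  have hζ0 : ζ ≠ 0 := hζ.ne_zero (by omega)
  have hne : ∀ j, (ζ ^ j)⁻¹ + 1 ≠ 0 := by
    intro j h
    have h1 : ζ ^ j = -1 := by
      rw [← inv_inv (ζ ^ j), eq_neg_of_add_eq_zero_left h, inv_neg, inv_one]
    have h2 : (ζ ^ j) ^ k = 1 := by rw [← pow_mul, mul_comm, pow_mul, hζ.pow_eq_one, one_pow]
    rw [h1, hk.neg_one_pow] at h2
    norm_num at h2
  have hrec : ∀ t, ∑ j ∈ Finset.range k, ζ ^ (j * (t + 1)) / ((ζ ^ j)⁻¹ + 1) =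
      ∑ j ∈ Finset.range k, ζ ^ (j * (t + 1)) -
        ∑ j ∈ Finset.range k, ζ ^ (j * t) / ((ζ ^ j)⁻¹ + 1) := by
    intro t
    rw [← Finset.sum_sub_distrib]
    refine Finset.sum_congr rfl fun j _ ↦ ?_
    have hj0 : ζ ^ j ≠ 0 := pow_ne_zero _ hζ0
    have h1 := hne j
    rw [eq_sub_iff_add_eq, ← add_div, div_eq_iff h1, mul_add, mul_one, pow_add, mul_add,
      mul_assoc, mul_inv_cancel₀ hj0, mul_one, mul_one, add_comm]
  have halt : ∀ t, t < k → ∑ j ∈ Finset.range k, ζ ^ (j * t) / ((ζ ^ j)⁻¹ + 1) =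
      (-1) ^ t * ∑ j ∈ Finset.range k, 1 / ((ζ ^ j)⁻¹ + 1) := by
    intro t ht
    induction t with
    | zero => simp
    | succ t ih =>
      rw [hrec, ih (by omega), sum_range_pow_of_isPrimitiveRoot hζ
        (Nat.not_dvd_of_pos_of_lt (by omega) ht)]
      ring
  obtain ⟨m, hm⟩ := hk
  -- At s = k - 1, which is even, the next power sum is k instead of 0; with S the value at s = 0
  -- this reads S = k - S.
  have hlast := hrec (2 * m)
  rw [← hm, halt (2 * m) (by omega), (even_two_mul m).neg_one_pow, one_mul] at hlast
  simp only [mul_comm _ k, pow_mul ζ k, hζ.pow_eq_one, one_pow, Finset.sum_const,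
    Finset.card_range, nsmul_eq_mul, mul_one] at hlast
  rw [halt s hs, eq_div_of_mul_eq two_ne_zero (show (∑ j ∈ Finset.range k,
    1 / ((ζ ^ j)⁻¹ + 1)) * 2 = k by linear_combination hlast)]

-- In generating functions, 2t(e^((x+1)t) - e^(xt))/(e^(2t) - 1) = 2t e^(xt)/(e^t + 1): a factor e^t
-- - 1 cancels. It is not invertible as a power series, only nonzero in a domain.
open PowerSeries in
lemma eulerPoly_eq_bernoulliFun (n : ℕ) (x : ℝ) :
    (n + 1) * eulerPoly n x =
      2 ^ (n + 1) * (bernoulliFun (n + 1) ((x + 1) / 2) - bernoulliFun (n + 1) (x / 2)) := by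
  set F : ℝ → PowerSeries ℝ := fun t ↦
    PowerSeries.mk fun n => Polynomial.aeval t ((1 / (n.factorial : ℚ)) • Polynomial.bernoulli n)
    with hF
  have hgen : ∀ t : ℝ, F t * (exp ℝ - 1) = PowerSeries.X * rescale t (exp ℝ) := fun t ↦
    Polynomial.bernoulli_generating_function t
  have hcoeff : ∀ t : ℝ, ∀ m : ℕ, coeff m (F t) = bernoulliFun m t / m.factorial := by
    intro t m
    simp only [hF, coeff_mk, map_smul, bernoulliFun, Polynomial.eval_map_algebraMap]
    rw [Algebra.smul_def]
    simp
    ring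
  have hadd : rescale ((x + 1) / 2) (exp ℝ) = rescale (x / 2) (exp ℝ) * rescale (1 / 2) (exp ℝ) := by
    rw [exp_mul_exp_eq_exp_add, add_div]
  have hD : (F ((x + 1) / 2) - F (x / 2)) * (exp ℝ - 1) =
      PowerSeries.X * (rescale (x / 2) (exp ℝ) * (rescale (1 / 2) (exp ℝ) - 1)) := by
    rw [sub_mul, hgen, hgen, hadd]
    ring
  have h2 := congrArg (rescale (2 : ℝ)) hD
  have hr : ∀ a : ℝ, rescale 2 (rescale a (exp ℝ)) = rescale (a * 2) (exp ℝ) := fun a ↦ by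
    rw [rescale_rescale]
  have hsq : rescale (2 : ℝ) (exp ℝ) = exp ℝ ^ 2 := by
    rw [exp_pow_eq_rescale_exp]; norm_num
  simp only [map_mul, map_sub, map_one, hr, rescale_X, hsq, div_mul_cancel₀ _ (two_ne_zero' ℝ),
    rescale_one, RingHom.id_apply] at h2
  have hne : exp ℝ - 1 ≠ 0 := by
    intro h
    have := congrArg (coeff 1) h
    simp [coeff_exp, coeff_one] at this
  have hc : constantCoeff (exp ℝ + 1) ≠ 0 := by
    simp
  have h3 : rescale 2 (F ((x + 1) / 2) - F (x / 2)) * (exp ℝ + 1) =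
      PowerSeries.X * (2 * rescale x (exp ℝ)) := by
    refine mul_right_cancel₀ hne ?_
    rw [map_sub]
    rw [show (C (2 : ℝ)) = (2 : PowerSeries ℝ) from map_ofNat C 2] at h2
    linear_combination h2
  have h4 : rescale 2 (F ((x + 1) / 2) - F (x / 2)) =
      PowerSeries.X * (2 * rescale x (exp ℝ) * (exp ℝ + 1)⁻¹) := by
    rw [← mul_assoc, ← h3, mul_assoc, PowerSeries.mul_inv_cancel _ hc, mul_one]
  have h5 := congrArg (coeff (n + 1)) h4
  rw [coeff_rescale, coeff_succ_X_mul, map_sub, hcoeff, hcoeff] at h5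
  rw [eulerPoly, ← h5, Nat.factorial_succ]
  push_cast
  have : (n.factorial : ℝ) ≠ 0 := by positivity
  field_simp

lemma bernoulliFn_eq_bernoulliFun {u : ℕ} {x : ℝ} (hx : x ∈ Set.Ico 0 1) (h : u ≠ 1 ∨ x ≠ 0) :
    bernoulliFn u x = bernoulliFun u x := by
  rw [bernoulliFn, Int.fract_eq_self.2 hx, if_neg (by tauto), bernoulliFun,
    Polynomial.eval_map_algebraMap]

lemma eulerFn_eq_eulerPoly {n : ℕ} {x : ℝ} (hx : x ∈ Set.Ico 0 1) :
    eulerFn n x = eulerPoly n x := by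
  rw [eulerFn, Int.fract_eq_self.2 hx, Int.floor_eq_zero_iff.2 hx, zpow_zero, one_mul]

lemma natCast_div_mem_Ico {j k : ℕ} (h : j < k) : (j : ℝ) / k ∈ Set.Ico (0 : ℝ) 1 := by
  have : (0 : ℝ) < k := by exact_mod_cast (Nat.zero_le j).trans_lt h
  exact ⟨by positivity, (div_lt_one this).2 (by exact_mod_cast h)⟩

lemma hasSum_div_pow_exp {m : ℕ} (hm : 2 ≤ m) {x : ℝ} (hx : x ∈ Set.Icc 0 1) :
    HasSum (fun n : ℤ ↦ exp (2 * Real.pi * I * (x * n)) / (n : ℂ) ^ m)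
      (-(2 * Real.pi * I) ^ m / m.factorial * bernoulliFun m x) := by
  refine (hasSum_one_div_pow_mul_fourier_mul_bernoulliFun hm hx).congr_fun fun n ↦ ?_
  rw [fourier_coe_apply]
  push_cast
  rw [div_one, one_div_mul_eq_div]
  congr 2
  ring

lemma char_zero_eq_zero {k : ℕ} {χ : DirichletCharacter ℂ k} (hχ : χ ≠ 1) : χ 0 = 0 := by
  rcases eq_or_ne k 1 with rfl | hk
  · exact absurd (DirichletCharacter.level_one χ) hχ
  · have := Fact.mk (show 1 ≠ k from hk.symm)
    have : Nontrivial (ZMod k) := ZMod.nontrivial_iff.2 hk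
    exact χ.map_zero

lemma sum_range_char {k : ℕ} [NeZero k] {χ : DirichletCharacter ℂ k} (hχ : χ ≠ 1) :
    ∑ j ∈ Finset.range k, χ (j : ZMod k) = 0 := by
  rw [← sum_zmod_eq_sum_range fun r ↦ χ r, MulChar.sum_eq_zero_of_ne_one hχ]

lemma neg_div_mem_integerComplement {j k : ℕ} (hj : 0 < j) (hjk : j < k) :
    ((0 - (0 : ℝ) - j) / k : ℂ) ∈ integerComplement := by
  rintro ⟨n, hn⟩
  have hk : (k : ℂ) ≠ 0 := by exact_mod_cast (by omega : k ≠ 0)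
  rw [eq_div_iff hk, ofReal_zero] at hn
  have h : n * k + j = 0 := by
    have : ((n * k + j : ℤ) : ℂ) = 0 := by push_cast; linear_combination hn
    exact_mod_cast this
  have h2 : (k : ℤ) ∣ j := ⟨-n, by linarith⟩
  exact absurd (Nat.le_of_dvd hj (Int.natCast_dvd_natCast.1 h2)) (by omega)

lemma neg_half_sub_div_mem_integerComplement {k : ℕ} (hk : Odd k) (j : ℕ) :
    ((0 - (k / 2 : ℝ) - j) / k : ℂ) ∈ integerComplement := by
  rintro ⟨n, hn⟩
  have hk0 : (k : ℂ) ≠ 0 := by exact_mod_cast (by rintro rfl; simp at hk : k ≠ 0)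
  rw [eq_div_iff hk0] at hn
  have h : 2 * (n * k) + k + 2 * j = 0 := by
    have : ((2 * (n * k) + k + 2 * j : ℤ) : ℂ) = 0 := by
      push_cast at hn ⊢; linear_combination 2 * hn
    exact_mod_cast this
  obtain ⟨m, rfl⟩ := hk
  push_cast at h
  omega

open Filter Topology in
lemma HasSum.tendsto_periodBlocks {k : ℕ} [NeZero k] {f : ℤ → ℂ} {S : ℂ} (h : HasSum f S) :
    Tendsto (fun Y ↦ ∑ n ∈ periodBlocks k Y, f n) atTop (𝓝 S) :=
  Tendsto.comp (f := periodBlocks k) (g := fun s ↦ ∑ n ∈ s, f n)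
    (by simpa [HasSum] using h) (_root_.tendsto_periodBlocks k)

open Filter Topology in
/-- The values at positive integers of the bilateral `L`-series of a primitive character. -/
lemma tendsto_dirichletSum_char {k : ℕ} [NeZero k] {χ : DirichletCharacter ℂ k} (hχ : χ ≠ 1)
    (hprim : χ.IsPrimitive) {u : ℕ} (hu : 1 ≤ u) :
    Tendsto (dirichletSum (fun r ↦ χ r) 0 u) atTop
      (𝓝 (-(2 * Real.pi * I) ^ u / u.factorial * (gaussSum χ⁻¹ ZMod.stdAddChar)⁻¹ *
        ∑ s ∈ Finset.range k, χ⁻¹ (s : ZMod k) * bernoulliFn u ((s : ℝ) / k))) := by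
  have hk : 0 < k := Nat.pos_of_ne_zero (NeZero.ne k)
  have hkC : (k : ℂ) ≠ 0 := Nat.cast_ne_zero.2 hk.ne'
  set G := gaussSum χ⁻¹ ZMod.stdAddChar with hG
  have hG0 : G ≠ 0 := gaussSum_ne_zero_of_isPrimitive hprim.inv
  have hχ' : χ⁻¹ ≠ 1 := inv_ne_one.2 hχ
  have hgauss : ∀ n : ℤ, ∑ s ∈ Finset.range k,
      χ⁻¹ (s : ZMod k) * exp (2 * Real.pi * I * (s * n / k)) = χ (n : ZMod k) * G := fun n ↦ by
    have := sum_dirichletCharacter_mul_exp hprim.inv n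
    rw [inv_inv] at this
    simpa only [mul_div_assoc] using this
  rcases eq_or_lt_of_le hu with rfl | hu2
  -- Since B_1(x) = x - 1/2 and the character sums to zero, only s/k survives. The convention at 0
  -- is harmless because the character vanishes there.
  · have hB : ∑ s ∈ Finset.range k, χ⁻¹ (s : ZMod k) * (bernoulliFn 1 ((s : ℝ) / k) : ℂ) =
        (k : ℂ)⁻¹ * ∑ s ∈ Finset.range k, χ⁻¹ (s : ZMod k) * s := by
      rw [← sub_zero ((k : ℂ)⁻¹ * _), ← mul_zero (1 / 2 : ℂ), ← sum_range_char hχ',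
        Finset.mul_sum, Finset.mul_sum, ← Finset.sum_sub_distrib]
      refine Finset.sum_congr rfl fun s hs ↦ ?_
      rcases Nat.eq_zero_or_pos s with rfl | hs0
      · simp [char_zero_eq_zero hχ']
      · have : (s : ℝ) / k ≠ 0 := by positivity
        rw [bernoulliFn_eq_bernoulliFun (natCast_div_mem_Ico (Finset.mem_range.1 hs)) (Or.inr this),
          bernoulliFun_one]
        push_cast
        ring
    set ζ := exp (2 * Real.pi * I / k) with hζdef
    have hζ : IsPrimitiveRoot ζ k := isPrimitiveRoot_exp k hk.ne'
    have hexp : ∀ m : ℕ, ζ ^ m = exp (2 * Real.pi * I * (m / k)) := fun m ↦ by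
      rw [hζdef, ← exp_nat_mul]; congr 1; ring
    have hw : ∀ j ∈ Finset.range k, χ (j : ZMod k) ≠ 0 →
        ((0 - (0 : ℝ) - j) / k : ℂ) ∈ integerComplement := by
      intro j hj hne
      refine neg_div_mem_integerComplement (Nat.pos_of_ne_zero ?_) (Finset.mem_range.1 hj)
      rintro rfl
      exact hne (by rw [Nat.cast_zero, char_zero_eq_zero hχ])
    have hlim := (tendsto_poleSum (fun r ↦ χ r) 0 0
      fun j hj ↦ hw j (Finset.mem_range.2 j.2) hj).neg
    simp only [← dirichletSum_one] at hlim
    convert hlim using 2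
    rw [cotSum_eq_sum_exp (sum_range_char hχ) 0 0
      fun j hj hne ↦ exp_two_pi_I_mul_ne_one_of_mem (hw j hj hne), hB]
    -- Multiplying by the Gauss sum expands χ(j) in powers of ζ^j; the inner sum over j is then
    -- affine in s, and its constant term is killed by ∑ χ⁻¹(s) = 0.
    have hS : (∑ j ∈ Finset.range k,
        χ (j : ZMod k) / (exp (2 * Real.pi * I * ((0 - (0 : ℝ) - j) / k)) - 1)) * G =
        ∑ s ∈ Finset.range k, χ⁻¹ (s : ZMod k) * s := by
      have h1 : (∑ j ∈ Finset.range k,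
          χ (j : ZMod k) / (exp (2 * Real.pi * I * ((0 - (0 : ℝ) - j) / k)) - 1)) * G =
          ∑ j ∈ Finset.Ico 1 k, ∑ s ∈ Finset.range k,
            χ⁻¹ (s : ZMod k) * (ζ ^ (j * s) / ((ζ ^ j)⁻¹ - 1)) := by
        rw [Finset.range_eq_Ico, Finset.sum_eq_sum_Ico_succ_bot hk, Nat.cast_zero,
          char_zero_eq_zero hχ, zero_div, zero_add, Finset.sum_mul]
        refine Finset.sum_congr rfl fun j _ ↦ ?_
        have h2 := hgauss j
        simp only [Int.cast_natCast] at h2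
        rw [div_mul_eq_mul_div, ← h2, Finset.sum_div, Finset.range_eq_Ico]
        refine Finset.sum_congr rfl fun s _ ↦ ?_
        rw [hexp, hexp, ← exp_neg, mul_div_assoc]
        push_cast
        congr 3
        · congr 1; ring
        · congr 2; ring
      rw [h1, Finset.sum_comm, ← add_zero (∑ s ∈ Finset.range k, χ⁻¹ (s : ZMod k) * (s : ℂ)),
        ← zero_mul (∑ j ∈ Finset.Ico 1 k, 1 / ((ζ ^ j)⁻¹ - 1)), ← sum_range_char hχ',
        Finset.sum_mul, ← Finset.sum_add_distrib]
      refine Finset.sum_congr rfl fun s hs ↦ ?_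
      rw [← Finset.mul_sum, sum_pow_div_inv_pow_sub_one hk hζ (Finset.mem_range.1 hs), mul_add]
    rw [← hS]
    field_simp
    simp
  -- For u ≥ 2, the Fourier series of B_u at the points s/k, weighted by χ⁻¹(s), have coefficients
  -- that sum to χ(n) times the Gauss sum.
  · have hsum := hasSum_sum fun s (hs : s ∈ Finset.range k) ↦
      (hasSum_div_pow_exp hu2 (Set.Ico_subset_Icc_self
        (natCast_div_mem_Ico (Finset.mem_range.1 hs)))).mul_left (χ⁻¹ (s : ZMod k))
    have hsum' := hsum.mul_left G⁻¹
    have e1 : dirichletSum (fun r ↦ χ r) 0 u = fun Y ↦ ∑ n ∈ periodBlocks k Y,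
        G⁻¹ * ∑ s ∈ Finset.range k, χ⁻¹ (s : ZMod k) *
          (exp (2 * Real.pi * I * (((s : ℝ) / k : ℝ) * n)) / (n : ℂ) ^ u) := by
      funext Y
      refine Finset.sum_congr rfl fun n _ ↦ ?_
      have e2 : ∑ s ∈ Finset.range k, χ⁻¹ (s : ZMod k) *
          (exp (2 * Real.pi * I * (((s : ℝ) / k : ℝ) * n)) / (n : ℂ) ^ u) =
          χ (n : ZMod k) * G / (n : ℂ) ^ u := by
        rw [← hgauss, Finset.sum_div]
        refine Finset.sum_congr rfl fun s _ ↦ ?_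
        rw [mul_div_assoc]
        push_cast
        congr 4
        ring
      rw [e2, ofReal_zero, add_zero]
      field_simp
    rw [e1]
    convert hsum'.tendsto_periodBlocks using 2
    rw [Finset.mul_sum, Finset.mul_sum]
    refine Finset.sum_congr rfl fun s hs ↦ ?_
    rw [bernoulliFn_eq_bernoulliFun (natCast_div_mem_Ico (Finset.mem_range.1 hs))
      (Or.inl (by omega))]
    ring

open Filter Topology in
/-- The values at positive integers of the bilateral `L`-series over odd integers. -/
lemma tendsto_dirichletSum_char_odd {k : ℕ} [NeZero k] (hk : Odd k) {χ : DirichletCharacter ℂ k}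
    (hχ : χ ≠ 1) (hprim : χ.IsPrimitive) {v : ℕ} (hv : 1 ≤ v) :
    Tendsto (dirichletSum (fun r ↦ χ⁻¹ (2 * r)) (k / 2) v) atTop
      (𝓝 (χ⁻¹ 2 * (gaussSum χ ZMod.stdAddChar)⁻¹ *
        ((2 * Real.pi * I) ^ v / (2 * (v - 1).factorial)) *
        ∑ j ∈ Finset.range k, (-1) ^ j * χ (j : ZMod k) * eulerFn (v - 1) ((j : ℝ) / k))) := by
  have hk0 : 0 < k := Nat.pos_of_ne_zero (NeZero.ne k)
  have hkC : (k : ℂ) ≠ 0 := Nat.cast_ne_zero.2 hk0.ne'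
  set G := gaussSum χ ZMod.stdAddChar with hG
  have hG0 : G ≠ 0 := gaussSum_ne_zero_of_isPrimitive hprim
  have hχ' : χ⁻¹ ≠ 1 := inv_ne_one.2 hχ
  have hgauss : ∀ n : ℤ, ∑ s ∈ Finset.range k,
      χ (s : ZMod k) * exp (2 * Real.pi * I * (s * n / k)) = χ⁻¹ (n : ZMod k) * G := fun n ↦ by
    simpa only [mul_div_assoc] using sum_dirichletCharacter_mul_exp hprim n
  obtain ⟨w, rfl⟩ : ∃ w, v = w + 1 := ⟨v - 1, by omega⟩
  rw [Nat.add_sub_cancel]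
  rcases Nat.eq_zero_or_pos w with rfl | hw0
  · set ζ := exp (2 * Real.pi * I / k) with hζdef
    have hζ : IsPrimitiveRoot ζ k := isPrimitiveRoot_exp k hk0.ne'
    have hexp : ∀ m : ℕ, ζ ^ m = exp (2 * Real.pi * I * (m / k)) := fun m ↦ by
      rw [hζdef, ← exp_nat_mul]; congr 1; ring
    have hw : ∀ j : ℕ, ((0 - (k / 2 : ℝ) - j) / k : ℂ) ∈ integerComplement :=
      neg_half_sub_div_mem_integerComplement hk
    have hlim := (tendsto_poleSum (fun r ↦ χ⁻¹ (2 * r)) (k / 2) 0 fun j _ ↦ by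
      simpa using hw j).neg
    simp only [← dirichletSum_one] at hlim
    convert hlim using 2
    have hsum0 : ∑ j ∈ Finset.range k, χ⁻¹ (2 * (j : ZMod k)) = 0 := by
      simp only [map_mul, ← Finset.mul_sum, sum_range_char hχ', mul_zero]
    rw [cotSum_eq_sum_exp (a := fun r ↦ χ⁻¹ (2 * r)) hsum0 (k / 2) 0
      fun j _ _ ↦ exp_two_pi_I_mul_ne_one_of_mem (by simpa using hw j)]
    -- The offset k/2 contributes e^(-πi) = -1.
    have hE : ∀ j : ℕ, exp (2 * Real.pi * I * ((0 - ((k / 2 : ℝ) : ℂ) - j) / k)) - 1 =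
        -((ζ ^ j)⁻¹ + 1) := by
      intro j
      rw [hexp, ← exp_neg, show 2 * Real.pi * I * ((0 - ((k / 2 : ℝ) : ℂ) - j) / k) =
        -(2 * Real.pi * I * (j / k)) - Real.pi * I by push_cast; field_simp; ring, exp_sub,
        exp_pi_mul_I]
      ring
    have hS : (∑ j ∈ Finset.range k, χ⁻¹ (j : ZMod k) / ((ζ ^ j)⁻¹ + 1)) * G =
        k / 2 * ∑ s ∈ Finset.range k, (-1) ^ s * χ (s : ZMod k) := by
      have h1 : (∑ j ∈ Finset.range k, χ⁻¹ (j : ZMod k) / ((ζ ^ j)⁻¹ + 1)) * G =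
          ∑ j ∈ Finset.range k, ∑ s ∈ Finset.range k,
            χ (s : ZMod k) * (ζ ^ (j * s) / ((ζ ^ j)⁻¹ + 1)) := by
        rw [Finset.sum_mul]
        refine Finset.sum_congr rfl fun j _ ↦ ?_
        have h2 := hgauss j
        simp only [Int.cast_natCast] at h2
        rw [div_mul_eq_mul_div, ← h2, Finset.sum_div]
        refine Finset.sum_congr rfl fun s _ ↦ ?_
        rw [hexp (j * s), mul_div_assoc]
        push_cast
        congr 4
        ring
      rw [h1, Finset.sum_comm, Finset.mul_sum]
      refine Finset.sum_congr rfl fun s hs ↦ ?_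
      rw [← Finset.mul_sum, sum_pow_div_inv_pow_add_one hk hζ (Finset.mem_range.1 hs)]
      ring
    have hEu : ∑ j ∈ Finset.range k, (-1) ^ j * χ (j : ZMod k) * (eulerFn 0 ((j : ℝ) / k) : ℂ) =
        ∑ s ∈ Finset.range k, (-1) ^ s * χ (s : ZMod k) := by
      refine Finset.sum_congr rfl fun j hj ↦ ?_
      have := eulerPoly_eq_bernoulliFun 0 ((j : ℝ) / k)
      rw [eulerFn_eq_eulerPoly (natCast_div_mem_Ico (Finset.mem_range.1 hj))]
      simp only [zero_add, bernoulliFun_one, Nat.cast_zero, one_mul, pow_one] at this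
      rw [this]
      push_cast
      ring
    have hR : ∑ j ∈ Finset.range k, χ⁻¹ (2 * (j : ZMod k)) /
        (exp (2 * Real.pi * I * ((0 - ((k / 2 : ℝ) : ℂ) - j) / k)) - 1) =
        -(χ⁻¹ 2 * ∑ j ∈ Finset.range k, χ⁻¹ (j : ZMod k) / ((ζ ^ j)⁻¹ + 1)) := by
      rw [Finset.mul_sum, ← Finset.sum_neg_distrib]
      refine Finset.sum_congr rfl fun j _ ↦ ?_
      rw [hE, map_mul, div_neg, mul_div_assoc]
    rw [hR, hEu, eq_div_of_mul_eq hG0 hS, zero_add, pow_one, Nat.factorial_zero, Nat.cast_one]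
    field_simp
  -- The expansions at y/2 and (y+1)/2 agree at even frequencies and are opposite at odd ones, so
  -- their difference keeps only the odd integers, doubled. The weight (-1)^s cancels the sign of
  -- e^(πis(2n+k)/k).
  · have hsum := hasSum_sum fun s (hs : s ∈ Finset.range k) ↦ by
      have hs' := natCast_div_mem_Ico (Finset.mem_range.1 hs)
      exact ((hasSum_div_pow_exp (m := w + 1) (by omega) (x := (s : ℝ) / k / 2)
        ⟨by linarith [hs'.1], by linarith [hs'.2]⟩).sub
        (hasSum_div_pow_exp (m := w + 1) (by omega) (x := ((s : ℝ) / k + 1) / 2)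
        ⟨by linarith [hs'.1], by linarith [hs'.2]⟩)).mul_left ((-1) ^ s * χ (s : ZMod k))
    -- The factor 2^w turns 2/(2n + k)^(w+1) into 1/(n + k/2)^(w+1).
    have hsum' := hsum.mul_left (χ⁻¹ 2 * G⁻¹ * 2 ^ w)
    have hinj : Function.Injective fun n : ℤ ↦ 2 * n + k := fun m n h ↦ by
      simp only at h; omega
    rw [← hinj.hasSum_iff] at hsum'
    · have e1 : dirichletSum (fun r ↦ χ⁻¹ (2 * r)) (k / 2) (w + 1) = fun Y ↦
          ∑ n ∈ periodBlocks k Y, ((fun b : ℤ ↦ χ⁻¹ 2 * G⁻¹ * 2 ^ w * ∑ s ∈ Finset.range k,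
            (-1) ^ s * χ (s : ZMod k) *
            (exp (2 * Real.pi * I * (((s : ℝ) / k / 2 : ℝ) * b)) / (b : ℂ) ^ (w + 1) -
            exp (2 * Real.pi * I * ((((s : ℝ) / k + 1) / 2 : ℝ) * b)) / (b : ℂ) ^ (w + 1))) ∘
              fun n : ℤ ↦ 2 * n + k) n := by
        funext Y
        refine Finset.sum_congr rfl fun n _ ↦ ?_
        rw [Function.comp_apply]
        have e2 : ∑ s ∈ Finset.range k, (-1) ^ s * χ (s : ZMod k) *
            (exp (2 * Real.pi * I * (((s : ℝ) / k / 2 : ℝ) * (2 * n + k : ℤ))) /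
              ((2 * n + k : ℤ) : ℂ) ^ (w + 1) -
            exp (2 * Real.pi * I * ((((s : ℝ) / k + 1) / 2 : ℝ) * (2 * n + k : ℤ))) /
              ((2 * n + k : ℤ) : ℂ) ^ (w + 1)) =
            2 * (χ⁻¹ (n : ZMod k) * G) / ((2 * n + k : ℤ) : ℂ) ^ (w + 1) := by
          rw [← hgauss, Finset.mul_sum, Finset.sum_div]
          refine Finset.sum_congr rfl fun s _ ↦ ?_
          have x1 : exp (2 * Real.pi * I * (((s : ℝ) / k / 2 : ℝ) * (2 * n + k : ℤ))) =
              (-1) ^ s * exp (2 * Real.pi * I * (s * n / k)) := by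
            rw [← exp_pi_mul_I, ← exp_nat_mul, ← exp_add]
            push_cast
            congr 1
            field_simp
            ring
          have x2 : exp (2 * Real.pi * I * ((((s : ℝ) / k + 1) / 2 : ℝ) * (2 * n + k : ℤ))) =
              -((-1) ^ s * exp (2 * Real.pi * I * (s * n / k))) := by
            have : (-1 : ℂ) = exp (k * (Real.pi * I)) := by
              rw [exp_nat_mul, exp_pi_mul_I, hk.neg_one_pow]
            rw [← x1, ← neg_one_mul, this, ← exp_add, exp_eq_exp_iff_exists_int]
            refine ⟨n, ?_⟩
            push_cast
            field_simp
            ring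
          have x3 : ((-1 : ℂ) ^ s) * (-1) ^ s = 1 := by rw [← mul_pow]; simp
          rw [x1, x2, ← sub_div, mul_div_assoc']
          congr 1
          linear_combination 2 * χ (s : ZMod k) * exp (2 * Real.pi * I * (s * n / k)) * x3
        rw [e2]
        simp only [map_mul]
        have hodd : ((n : ℂ) + ((k / 2 : ℝ) : ℂ)) = ((2 * n + k : ℤ) : ℂ) / 2 := by
          push_cast; ring
        rw [hodd, div_pow]
        have hne : ((2 * n + k : ℤ) : ℂ) ≠ 0 := by
          obtain ⟨m, rfl⟩ := hk
          exact_mod_cast (by push_cast; omega : (2 * n + (2 * m + 1 : ℕ) : ℤ) ≠ 0)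
        field_simp
        ring
      rw [e1]
      convert hsum'.tendsto_periodBlocks using 2
      rw [Finset.mul_sum, Finset.mul_sum]
      refine Finset.sum_congr rfl fun s hs ↦ ?_
      rw [eulerFn_eq_eulerPoly (natCast_div_mem_Ico (Finset.mem_range.1 hs))]
      have hE : (eulerPoly w ((s : ℝ) / k) : ℂ) = 2 ^ (w + 1) / (w + 1) *
          (bernoulliFun (w + 1) (((s : ℝ) / k + 1) / 2) -
            bernoulliFun (w + 1) ((s : ℝ) / k / 2)) := by
        have h1 : (w + 1 : ℝ) ≠ 0 := by positivity
        have := eq_div_of_mul_eq h1 ((mul_comm _ _).trans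
          (eulerPoly_eq_bernoulliFun w ((s : ℝ) / k)))
        rw [this]
        push_cast
        ring
      have hf : (w.factorial : ℂ) ≠ 0 := Nat.cast_ne_zero.2 w.factorial_ne_zero
      have hw1 : (w + 1 : ℂ) ≠ 0 := by exact_mod_cast w.succ_ne_zero
      rw [hE, Nat.factorial_succ]
      push_cast
      field_simp
      ring
    · intro b hb
      have hev : Even b := by
        by_contra hodd
        rw [Int.not_even_iff_odd] at hodd
        obtain ⟨m, hm⟩ := hodd
        obtain ⟨l, hl⟩ := hk
        exact hb ⟨m - l, by simp only; rw [hm, hl]; push_cast; ring⟩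
      obtain ⟨c, rfl⟩ := hev
      refine mul_eq_zero_of_right _ (Finset.sum_eq_zero fun s _ ↦ mul_eq_zero_of_right _ ?_)
      rw [← sub_div, div_eq_zero_iff, sub_eq_zero, exp_eq_exp_iff_exists_int]
      refine Or.inl ⟨-c, ?_⟩
      push_cast
      ring

/-! ### Parity -/

lemma char_neg_one_mul_self {k : ℕ} (χ : DirichletCharacter ℂ k) : χ (-1) * χ (-1) = 1 := by
  rw [← map_mul, neg_mul_neg, one_mul, map_one]

lemma inv_char_neg_one {k : ℕ} (χ : DirichletCharacter ℂ k) : χ⁻¹ (-1) = χ (-1) := by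
  have h : χ⁻¹ (-1) * χ (-1) = 1 := by
    rw [← MulChar.mul_apply, inv_mul_cancel, MulChar.one_apply isUnit_one.neg]
  linear_combination χ (-1) * h - χ⁻¹ (-1) * char_neg_one_mul_self χ

lemma cot_pi_mul_neg_add_int (z : ℂ) (m : ℤ) :
    cot (Real.pi * (-z + m)) = -cot (Real.pi * z) := by
  have h : cot (Real.pi * (-z + m)) = cot (Real.pi * -z) := by
    rw [Complex.cot_pi_eq_exp_ratio, Complex.cot_pi_eq_exp_ratio, mul_add, exp_add,
      show 2 * Real.pi * I * (m : ℂ) = m * (2 * Real.pi * I) by ring, exp_int_mul_two_pi_mul_I,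
      mul_one]
  rw [h, mul_neg, Complex.cot, Complex.cos_neg, Complex.sin_neg, div_neg, Complex.cot]

lemma sum_fin_eq_sum_zmod {k : ℕ} [NeZero k] (f : ZMod k → ℕ → ℂ) :
    ∑ j : Fin k, f ((j : ℕ) : ZMod k) j = ∑ r : ZMod k, f r r.val := by
  rw [sum_zmod_eq_sum_range, ← Finset.sum_range fun j ↦ f (j : ZMod k) j]
  refine Finset.sum_congr rfl fun j hj ↦ ?_
  rw [ZMod.val_cast_of_lt (Finset.mem_range.1 hj)]

/-- The cotangent is odd and π-periodic. Under r ↦ -r the representatives add up to a multiple of k,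
as does 2σ, so the reflected arguments differ by integers. -/
lemma cotSum_neg {k : ℕ} [NeZero k] {a : ZMod k → ℂ} {ε : ℂ} (ha : ∀ r, a (-r) = ε * a r)
    {σ : ℝ} {m : ℤ} (hσ : 2 * σ = m * k) (w : ℂ) :
    cotSum a σ (-w) = -ε * cotSum a σ w := by
  have hk : (k : ℂ) ≠ 0 := Nat.cast_ne_zero.2 (NeZero.ne k)
  have h : ∀ w : ℂ, cotSum a σ w = ∑ r : ZMod k, a r *
      (Real.pi / k * cot (Real.pi * ((w - σ - r.val) / k))) := fun w ↦
    sum_fin_eq_sum_zmod fun r j ↦ a r * (Real.pi / k * cot (Real.pi * ((w - σ - j) / k)))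
  rw [h, h, ← Equiv.sum_comp (Equiv.neg (ZMod k)), Finset.mul_sum]
  refine Finset.sum_congr rfl fun r _ ↦ ?_
  obtain ⟨l, hl⟩ : (k : ℤ) ∣ r.val + (-r).val := by
    rw [← ZMod.intCast_zmod_eq_zero_iff_dvd]
    simp
  have hl' : (r.val : ℂ) + (-r).val = k * l := by exact_mod_cast congrArg (Int.cast : ℤ → ℂ) hl
  have hσ' : 2 * (σ : ℂ) = m * k := by exact_mod_cast congrArg ofReal hσ
  rw [Equiv.neg_apply, ha, show (-w - σ - (-r).val) / (k : ℂ) =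
    -((w - σ - r.val) / k) + ((-(m + l) : ℤ) : ℂ) by
      push_cast
      field_simp
      linear_combination -hσ' - hl', cot_pi_mul_neg_add_int]
  ring

/-- This follows from B_u(1 - x) = (-1)^u B_u(x) under s ↦ k - s. It allows the χ(-1) from the Gauss
sums to be traded for a sign, with no case split on the parity of χ. -/
lemma char_neg_one_mul_sum_bernoulliFn {k : ℕ} [NeZero k] {ψ : DirichletCharacter ℂ k}
    (hψ : ψ ≠ 1) (u : ℕ) :
    ψ (-1) * ∑ s ∈ Finset.range k, ψ (s : ZMod k) * (bernoulliFn u ((s : ℝ) / k) : ℂ) =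
      (-1) ^ u * ∑ s ∈ Finset.range k, ψ (s : ZMod k) * (bernoulliFn u ((s : ℝ) / k) : ℂ) := by
  have h : ∑ s ∈ Finset.range k, ψ (s : ZMod k) * (bernoulliFn u ((s : ℝ) / k) : ℂ) =
      ∑ r : ZMod k, ψ r * (bernoulliFn u ((r.val : ℝ) / k) : ℂ) := by
    rw [← sum_fin_eq_sum_zmod fun r s ↦ ψ r * (bernoulliFn u ((s : ℝ) / k) : ℂ),
      ← Finset.sum_range fun s ↦ ψ (s : ZMod k) * (bernoulliFn u ((s : ℝ) / k) : ℂ)]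
  have hk : (0 : ℝ) < k := by exact_mod_cast Nat.pos_of_ne_zero (NeZero.ne k)
  rw [h]
  nth_rw 1 [← Equiv.sum_comp (Equiv.neg (ZMod k))]
  rw [Finset.mul_sum, Finset.mul_sum]
  refine Finset.sum_congr rfl fun r _ ↦ ?_
  rcases eq_or_ne r 0 with rfl | hr
  · simp [char_zero_eq_zero hψ]
  have hr0 : r.val ≠ 0 := (ZMod.val_eq_zero r).not.2 hr
  have hlt := r.val_lt
  have : NeZero r := ⟨hr⟩
  have hv : ((-r).val : ℝ) / k = 1 - r.val / k := by
    rw [ZMod.val_neg_of_ne_zero, Nat.cast_sub hlt.le, sub_div, div_self hk.ne']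
  have hx : (r.val : ℝ) / k ≠ 0 := div_ne_zero (Nat.cast_ne_zero.2 hr0) hk.ne'
  have hx' := natCast_div_mem_Ico hlt
  rw [Equiv.neg_apply, hv, bernoulliFn_eq_bernoulliFun hx' (Or.inr hx),
    bernoulliFn_eq_bernoulliFun ⟨by linarith [hx'.2], by
      have := lt_of_le_of_ne hx'.1 hx.symm; linarith⟩ (Or.inr (by linarith [hx'.2])),
    bernoulliFun_eval_one_sub, ← neg_one_mul r, map_mul]
  push_cast
  linear_combination ψ r * (-1) ^ u * bernoulliFun u ((r.val : ℝ) / k) * char_neg_one_mul_self ψ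

/-! ### Absolute convergence and folding of the bilateral series -/

/-- From e^t - 1 ≥ t. This linear growth gives both nonvanishing denominators and, with one factor n
from n^p, comparison with ∑ 1/n². -/
lemma le_norm_exp_add {t φ : ℝ} {δ : ℂ} (hδ : ‖δ‖ = 1) :
    t ≤ ‖exp (t - φ * I) + δ‖ := by
  have h := norm_sub_le (exp (t - φ * I) + δ) δ
  rw [add_sub_cancel_right, norm_exp, hδ] at h
  have h2 : (t - φ * I : ℂ).re = t := by simp
  rw [h2] at h
  linarith [Real.add_one_le_exp t]

lemma phase_eq (j k : ℕ) :
    2 * (Real.pi : ℂ) * I * j / k = ((2 * Real.pi * j / k : ℝ) : ℂ) * I := by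
  push_cast
  ring

lemma alphaTerm_denom_ne_zero {α : ℝ} (hα : 0 < α) (j k : ℕ) {n : ℕ} (hn : n ≠ 0) :
    exp (2 * n * α - 2 * Real.pi * I * j / k) + 1 ≠ 0 := by
  have h := le_norm_exp_add (t := 2 * n * α) (φ := 2 * Real.pi * j / k) (δ := 1) norm_one
  rw [phase_eq]
  push_cast at h ⊢
  exact norm_pos_iff.1 (lt_of_lt_of_le (by positivity) h)

lemma betaTerm_denom_ne_zero {β : ℝ} (hβ : 0 < β) (j k n : ℕ) :
    exp ((2 * n + 1 : ℕ) * β - 2 * Real.pi * I * j / k) - 1 ≠ 0 := by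
  have h := le_norm_exp_add (t := (2 * n + 1 : ℕ) * β) (φ := 2 * Real.pi * j / k) (δ := -1) (by simp)
  rw [phase_eq, sub_eq_add_neg _ (1 : ℂ)]
  push_cast at h ⊢
  exact norm_pos_iff.1 (lt_of_lt_of_le (by positivity) h)

lemma summable_alphaTerm {k : ℕ} (χ : DirichletCharacter ℂ k) {p : ℕ} (hp : p ≠ 0) {α : ℝ}
    (hα : 0 < α) (j : ℕ) : Summable fun n : ℕ ↦ alphaTerm χ p α j (n + 1) := by
  have hs := ((summable_nat_add_iff 1).2 (Real.summable_one_div_nat_pow.2 one_lt_two)).mul_left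
    ((2 * α)⁻¹)
  refine hs.of_norm_bounded fun n ↦ ?_
  have h := le_norm_exp_add (t := 2 * (n + 1 : ℕ) * α) (φ := 2 * Real.pi * j / k) (δ := 1) norm_one
  rw [alphaTerm, norm_div, norm_mul, norm_pow, norm_natCast, phase_eq, mul_one_div,
    ← one_div, div_div]
  refine div_le_div₀ zero_le_one (χ.norm_le_one _) (by positivity) ?_
  have h1 : ((n + 1 : ℕ) : ℝ) ≤ ((n + 1 : ℕ) : ℝ) ^ p := le_self_pow₀ (by simp) hp
  push_cast at h h1 ⊢
  calc 2 * α * (n + 1 : ℝ) ^ 2 = (n + 1) * (2 * (n + 1) * α) := by ring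
    _ ≤ _ := by gcongr

lemma summable_betaTerm {k : ℕ} (χ : DirichletCharacter ℂ k) {p : ℕ} (hp : p ≠ 0) {β : ℝ}
    (hβ : 0 < β) (j : ℕ) : Summable fun n : ℕ ↦ betaTerm χ p β j n := by
  have hs := ((summable_nat_add_iff 1).2 (Real.summable_one_div_nat_pow.2 one_lt_two)).mul_left
    β⁻¹
  refine hs.of_norm_bounded fun n ↦ ?_
  have h := le_norm_exp_add (t := (2 * n + 1 : ℕ) * β) (φ := 2 * Real.pi * j / k) (δ := -1) (by simp)
  rw [betaTerm, norm_div, norm_mul, norm_pow, norm_natCast, phase_eq, mul_one_div,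
    ← one_div, div_div, sub_eq_add_neg _ (1 : ℂ)]
  refine div_le_div₀ zero_le_one ((star χ).norm_le_one _) (by positivity) ?_
  have h1 : ((2 * n + 1 : ℕ) : ℝ) ≤ ((2 * n + 1 : ℕ) : ℝ) ^ p := le_self_pow₀ (by simp) hp
  push_cast at h h1 ⊢
  have h0 : (0 : ℝ) ≤ n := n.cast_nonneg
  calc β * (n + 1 : ℝ) ^ 2 = (n + 1) * ((n + 1) * β) := by ring
    _ ≤ (2 * n + 1) * ((2 * n + 1) * β) := by gcongr <;> linarith
    _ ≤ _ := by gcongr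

lemma tsum_int_of_even {f : ℤ → ℂ} (hf : Summable f) (hev : ∀ n, f (-n) = f n) (h0 : f 0 = 0) :
    ∑' n : ℤ, f n = 2 * ∑' n : ℕ, f ((n + 1 : ℕ) : ℤ) := by
  rw [tsum_int_eq_zero_add_two_mul_tsum_pnat hev hf, h0, zero_add, nsmul_eq_mul,
    tsum_pnat_eq_tsum_succ (f := fun n : ℕ ↦ f n)]
  simp

lemma tsum_int_of_reflect {f : ℤ → ℂ} (hf : Summable f) (hev : ∀ n, f (-(n + 1)) = f n) :
    ∑' n : ℤ, f n = 2 * ∑' n : ℕ, f n := by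
  have h1 : Summable fun n : ℕ ↦ f n := hf.comp_injective Nat.cast_injective
  rw [tsum_of_nat_of_neg_add_one h1 (by simpa only [hev] using h1), two_mul]
  simp only [hev]

lemma sum_range_eq_sum_Icc {k : ℕ} (hk : 0 < k) {f : ℕ → ℂ} (h0 : f 0 = 0) :
    ∑ j ∈ Finset.range k, f j = ∑ j ∈ Finset.Icc 1 (k - 1), f j := by
  rw [Finset.range_eq_Ico, Finset.sum_eq_sum_Ico_succ_bot hk, h0, zero_add]
  refine Finset.sum_congr ?_ fun _ _ ↦ rfl
  ext j
  simp only [Finset.mem_Ico, Finset.mem_Icc]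
  omega

/-- At w = -(kαn/π)i the exponential e^(2πiw/k) is e^(2nα), and the offset k/2 changes the -1 of the
denominator to +1. The summand is even in n because the two factors χ(-1) and the two signs cancel.
-/
lemma tsum_cotSum_eq_alpha {k : ℕ} [NeZero k] {χ : DirichletCharacter ℂ k} (hχ : χ ≠ 1)
    {p : ℕ} (hp : Odd p) {α : ℝ} (hα : 0 < α)
    (hs : Summable fun n : ℤ ↦ χ (n : ZMod k) / ((n : ℂ) + (0 : ℝ)) ^ p *
      cotSum (fun r ↦ χ⁻¹ (2 * r)) (k / 2) ((-(k * α / Real.pi) * (n + 0) : ℝ) * I)) :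
    ∑' n : ℤ, χ (n : ZMod k) / ((n : ℂ) + (0 : ℝ)) ^ p *
      cotSum (fun r ↦ χ⁻¹ (2 * r)) (k / 2) ((-(k * α / Real.pi) * (n + 0) : ℝ) * I) =
    -(4 * Real.pi * I / k) * χ⁻¹ 2 * ∑ j ∈ Finset.Icc 1 (k - 1), star χ (j : ZMod k) *
      ∑' n : ℕ, alphaTerm χ p α j (n + 1) := by
  have hk : 0 < k := Nat.pos_of_ne_zero (NeZero.ne k)
  have hkC : (k : ℂ) ≠ 0 := Nat.cast_ne_zero.2 hk.ne'
  have hπ : (Real.pi : ℂ) ≠ 0 := ofReal_ne_zero.2 Real.pi_ne_zero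
  have hχ' : χ⁻¹ ≠ 1 := inv_ne_one.2 hχ
  have hb0 : ∑ j ∈ Finset.range k, χ⁻¹ (2 * (j : ZMod k)) = 0 := by
    simp only [map_mul, ← Finset.mul_sum, sum_range_char hχ', mul_zero]
  rw [tsum_int_of_even hs]
  · have hsum : ∑ j ∈ Finset.Icc 1 (k - 1), star χ (j : ZMod k) *
        ∑' n : ℕ, alphaTerm χ p α j (n + 1) =
        ∑' n : ℕ, ∑ j ∈ Finset.Icc 1 (k - 1), star χ (j : ZMod k) * alphaTerm χ p α j (n + 1) := by
      rw [Summable.tsum_finsetSum fun j _ ↦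
        (summable_alphaTerm χ hp.pos.ne' hα j).mul_left (star χ (j : ZMod k))]
      exact Finset.sum_congr rfl fun j _ ↦ tsum_mul_left.symm
    rw [hsum, ← tsum_mul_left, ← tsum_mul_left]
    refine tsum_congr fun n ↦ ?_
    have hexp : ∀ j : ℕ, exp (2 * Real.pi * I * ((((-(k * α / Real.pi) *
        (((n + 1 : ℕ) : ℤ) + 0) : ℝ) : ℂ) * I - ((k / 2 : ℝ) : ℂ) - j) / k)) - 1 =
        -(exp (2 * (n + 1 : ℕ) * α - 2 * Real.pi * I * j / k) + 1) := by
      intro j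
      rw [show 2 * Real.pi * I * ((((-(k * α / Real.pi) *
        (((n + 1 : ℕ) : ℤ) + 0) : ℝ) : ℂ) * I - ((k / 2 : ℝ) : ℂ) - j) / k) =
        (2 * (n + 1 : ℕ) * α - 2 * Real.pi * I * j / k) - Real.pi * I by
          push_cast
          field_simp
          ring_nf
          rw [I_sq]
          ring, exp_sub, exp_pi_mul_I]
      ring
    rw [cotSum_eq_sum_exp (a := fun r ↦ χ⁻¹ (2 * r)) hb0]
    · rw [sum_range_eq_sum_Icc hk (by simp [char_zero_eq_zero hχ']), Finset.mul_sum,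
        Finset.mul_sum, Finset.mul_sum, Finset.mul_sum]
      refine Finset.sum_congr rfl fun j _ ↦ ?_
      have hd := alphaTerm_denom_ne_zero hα j k n.succ_ne_zero
      rw [Nat.succ_eq_add_one] at hd
      rw [hexp, alphaTerm, MulChar.star_eq_inv, map_mul]
      have hn : ((n + 1 : ℕ) : ℂ) ≠ 0 := Nat.cast_ne_zero.2 n.succ_ne_zero
      simp only [Int.cast_natCast, ofReal_zero, add_zero]
      field_simp
      ring
    · intro j _ _
      rw [← sub_ne_zero, hexp]
      exact neg_ne_zero.2 (alphaTerm_denom_ne_zero hα j k n.succ_ne_zero)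
  · intro n
    have hc : cotSum (fun r ↦ χ⁻¹ (2 * r)) (k / 2) (((-(k * α / Real.pi) *
        (((-n : ℤ) : ℝ) + 0) : ℝ) : ℂ) * I) = -χ (-1) * cotSum (fun r ↦ χ⁻¹ (2 * r)) (k / 2)
        (((-(k * α / Real.pi) * ((n : ℝ) + 0) : ℝ) : ℂ) * I) := by
      rw [← cotSum_neg (a := fun r ↦ χ⁻¹ (2 * r)) (ε := χ (-1)) (σ := k / 2) (m := 1)]
      · congr 1
        push_cast
        ring
      · intro r
        rw [← inv_char_neg_one, ← map_mul]
        congr 1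
        ring
      · push_cast
        ring
    rw [hc, show ((-n : ℤ) : ZMod k) = -1 * (n : ZMod k) by push_cast; ring, map_mul,
      show ((-n : ℤ) : ℂ) + (0 : ℝ) = -((n : ℂ) + (0 : ℝ)) by push_cast; ring, hp.neg_pow, div_neg]
    linear_combination χ (n : ZMod k) / ((n : ℂ) + (0 : ℝ)) ^ p *
      cotSum (fun r ↦ χ⁻¹ (2 * r)) (k / 2) (((-(k * α / Real.pi) * ((n : ℝ) + 0) : ℝ) : ℂ) * I) *
      char_neg_one_mul_self χ
  · simp [char_zero_eq_zero hχ]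

lemma tsum_cotSum_eq_beta {k : ℕ} [NeZero k] (hk : Odd k) {χ : DirichletCharacter ℂ k}
    (hχ : χ ≠ 1) {p : ℕ} (hp : Odd p) {β : ℝ} (hβ : 0 < β)
    (hs : Summable fun n : ℤ ↦ χ⁻¹ (2 * (n : ZMod k)) / ((n : ℂ) + (k / 2 : ℝ)) ^ p *
      cotSum (fun r ↦ χ r) 0 ((k * β / Real.pi * (n + k / 2) : ℝ) * I)) :
    ∑' n : ℤ, χ⁻¹ (2 * (n : ZMod k)) / ((n : ℂ) + (k / 2 : ℝ)) ^ p *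
      cotSum (fun r ↦ χ r) 0 ((k * β / Real.pi * (n + k / 2) : ℝ) * I) =
    -(4 * Real.pi * I / k) * 2 ^ p * χ (-1) * ∑ j ∈ Finset.Icc 1 (k - 1), χ (j : ZMod k) *
      ∑' n : ℕ, betaTerm χ p β j n := by
  have hk0 : 0 < k := Nat.pos_of_ne_zero (NeZero.ne k)
  have hkC : (k : ℂ) ≠ 0 := Nat.cast_ne_zero.2 hk0.ne'
  have hπ : (Real.pi : ℂ) ≠ 0 := ofReal_ne_zero.2 Real.pi_ne_zero
  have hneg : ∀ w, cotSum (fun r ↦ χ r) 0 (-w) = -χ (-1) * cotSum (fun r ↦ χ r) 0 w := fun w ↦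
    cotSum_neg (m := 0) (fun r ↦ by rw [← map_mul, neg_one_mul]) (by simp) w
  obtain ⟨t, ht⟩ := hk
  set f : ℤ → ℂ := fun m ↦ χ⁻¹ ((2 * m + 1 : ℤ) : ZMod k) / (((2 * m + 1 : ℤ) : ℂ) / 2) ^ p *
    cotSum (fun r ↦ χ r) 0 ((k * β / Real.pi * ((2 * m + 1 : ℤ) / 2) : ℝ) * I) with hf
  -- With k = 2t + 1, the translation m = n + t turns n + k/2 into (2m + 1)/2; the 2^p comes from
  -- these halves.
  have hfe : (fun n : ℤ ↦ χ⁻¹ (2 * (n : ZMod k)) / ((n : ℂ) + (k / 2 : ℝ)) ^ p *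
      cotSum (fun r ↦ χ r) 0 ((k * β / Real.pi * (n + k / 2) : ℝ) * I)) =
      f ∘ Equiv.addRight (t : ℤ) := by
    funext n
    have e : 2 * (n + t) + 1 = 2 * n + (k : ℤ) := by rw [ht]; push_cast; ring
    simp only [hf, Function.comp_apply, Equiv.coe_addRight, e]
    push_cast
    rw [ZMod.natCast_self, add_zero, add_div, mul_div_cancel_left₀ _ (two_ne_zero' ℂ)]
  have hfs : Summable f := by
    rw [hfe] at hs
    exact (Equiv.addRight (t : ℤ)).summable_iff.1 hs
  rw [hfe]
  rw [show tsum (f ∘ Equiv.addRight (t : ℤ)) = ∑' n, f n from (Equiv.addRight (t : ℤ)).tsum_eq f,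
    tsum_int_of_reflect hfs]
  · have hsum : ∑ j ∈ Finset.Icc 1 (k - 1), χ (j : ZMod k) * ∑' n : ℕ, betaTerm χ p β j n =
        ∑' n : ℕ, ∑ j ∈ Finset.Icc 1 (k - 1), χ (j : ZMod k) * betaTerm χ p β j n := by
      rw [Summable.tsum_finsetSum fun j _ ↦
        (summable_betaTerm χ hp.pos.ne' hβ j).mul_left (χ (j : ZMod k))]
      exact Finset.sum_congr rfl fun j _ ↦ tsum_mul_left.symm
    rw [hsum, ← tsum_mul_left, ← tsum_mul_left]
    refine tsum_congr fun n ↦ ?_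
    -- The argument is negated so that the exponent is +(2n+1)β; oddness of the cotangent sum pays
    -- -χ(-1) for it.
    set w : ℂ := -(((k * β / Real.pi * ((2 * n + 1 : ℕ) / 2) : ℝ) : ℂ) * I) with hw
    have hexp : ∀ j : ℕ, exp (2 * Real.pi * I * ((w - (0 : ℝ) - j) / k)) =
        exp ((2 * n + 1 : ℕ) * β - 2 * Real.pi * I * j / k) := by
      intro j
      congr 1
      rw [hw]
      push_cast
      field_simp
      ring_nf
      rw [I_sq]
      ring
    have hfn : f n = χ⁻¹ ((2 * n + 1 : ℕ) : ZMod k) / (((2 * n + 1 : ℕ) : ℂ) / 2) ^ p *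
        (-χ (-1) * cotSum (fun r ↦ χ r) 0 w) := by
      rw [← hneg, hw, neg_neg]
      simp only [hf]
      push_cast
      rfl
    rw [hfn, cotSum_eq_sum_exp (a := fun r ↦ χ r) (sum_range_char hχ)]
    · rw [sum_range_eq_sum_Icc hk0 (by simp [char_zero_eq_zero hχ]), Finset.mul_sum,
        Finset.mul_sum, Finset.mul_sum, Finset.mul_sum, Finset.mul_sum]
      refine Finset.sum_congr rfl fun j _ ↦ ?_
      have hd := betaTerm_denom_ne_zero hβ j k n
      rw [hexp, betaTerm, MulChar.star_eq_inv, div_pow]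
      have hn : ((2 * n + 1 : ℕ) : ℂ) ≠ 0 := Nat.cast_ne_zero.2 (2 * n).succ_ne_zero
      field_simp
      ring
    · intro j _ _
      rw [hexp, ← sub_ne_zero]
      exact betaTerm_denom_ne_zero hβ j k n
  · intro m
    have e : 2 * -(m + 1) + 1 = -(2 * m + 1) := by ring
    simp only [hf, e]
    generalize 2 * m + 1 = N
    rw [show ((k * β / Real.pi * ((-N : ℤ) / 2) : ℝ) : ℂ) * I =
      -(((k * β / Real.pi * (N / 2) : ℝ) : ℂ) * I) by push_cast; ring, hneg,
      show ((-N : ℤ) : ZMod k) = -1 * (N : ZMod k) by push_cast; ring, map_mul, inv_char_neg_one,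
      show ((-N : ℤ) : ℂ) / 2 = -((N : ℂ) / 2) by push_cast; ring, hp.neg_pow, div_neg]
    linear_combination χ⁻¹ (N : ZMod k) / ((N : ℂ) / 2) ^ p *
      cotSum (fun r ↦ χ r) 0 (((k * β / Real.pi * (N / 2) : ℝ) : ℂ) * I) *
      char_neg_one_mul_self χ

/-! ### Specialization and comparison of constants -/

lemma half_le_abs_int_add_zero {n : ℤ} (hn : n ≠ 0) : 1 / 2 ≤ |(n : ℝ) + 0| := by
  rw [add_zero]
  have : (1 : ℝ) ≤ |(n : ℝ)| := by exact_mod_cast Int.one_le_abs hn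
  linarith

lemma half_le_abs_int_add_half {k : ℕ} (hk : Odd k) (n : ℤ) : 1 / 2 ≤ |(n : ℝ) + k / 2| := by
  have h : 2 * n + k ≠ 0 := by
    obtain ⟨t, rfl⟩ := hk
    push_cast
    omega
  have h1 : (1 : ℝ) ≤ |2 * (n : ℝ) + k| := by exact_mod_cast Int.one_le_abs h
  have h2 : (n : ℝ) + k / 2 = (2 * n + k) / 2 := by ring
  rw [h2, abs_div, abs_two]
  linarith

lemma bernoulliCharFn_zero {k : ℕ} [NeZero k] {u : ℕ} (hu : 1 ≤ u) (χ : DirichletCharacter ℂ k) :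
    bernoulliCharFn u χ 0 = (k : ℂ) ^ (u - 1) *
      ∑ s ∈ Finset.range k, χ⁻¹ (s : ZMod k) * (bernoulliFn u ((s : ℝ) / k) : ℂ) := by
  rw [bernoulliCharFn, MulChar.star_eq_inv, ← zpow_natCast, Nat.cast_sub hu, Nat.cast_one]
  simp only [add_zero]

lemma eulerCharFn_star_zero {k : ℕ} (m : ℕ) (χ : DirichletCharacter ℂ k) :
    eulerCharFn m (star χ) 0 = (k : ℂ) ^ m *
      ∑ j ∈ Finset.range k, (-1) ^ j * χ (j : ZMod k) * (eulerFn m ((j : ℝ) / k) : ℂ) := by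
  rw [eulerCharFn, star_star]
  simp only [add_zero]

/-- The fractional parts of the exponents combine to (αβ)^(u/2) = c^u, leaving natural powers. -/
lemma rpow_mul_rpow_of_mul_eq_sq {α β c : ℝ} (hα : 0 < α) (hβ : 0 < β) (hc : 0 < c)
    (h : α * β = c ^ 2) (u w g : ℕ) (hg : u + w = 2 * g + 1) :
    α ^ (((u + w : ℕ) : ℝ) - u / 2) * β ^ ((((u + w : ℕ) : ℝ) - 1 + u) / 2) =
      α ^ w * β ^ g * c ^ u := by
  have e1 : ((u + w : ℕ) : ℝ) - u / 2 = w + (u : ℝ) / 2 := by push_cast; ring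
  have e2 : (((u + w : ℕ) : ℝ) - 1 + u) / 2 = g + (u : ℝ) / 2 := by rw [hg]; push_cast; ring
  have e3 : c ^ u = (α * β) ^ ((u : ℝ) / 2) := by
    rw [h, ← Real.rpow_natCast c 2, ← Real.rpow_mul hc.le, ← Real.rpow_natCast]
    congr 1
    push_cast
    ring
  rw [e1, e2, Real.rpow_add hα, Real.rpow_add hβ, Real.rpow_natCast, Real.rpow_natCast, e3,
    Real.mul_rpow hα.le hβ.le]
  ring

theorem mainTheorem10 (k : ℕ) (hk : Odd k) (χ : DirichletCharacter ℂ k)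
    (hχ : χ ≠ 1) (hprim : χ.IsPrimitive) (p : ℕ) (hp : Odd p)
    (α β : ℝ) (hα : 0 < α) (hβ : 0 < β) (hαβ : α * β = (Real.pi / k) ^ 2) :
    (∀ j ∈ Finset.Icc 1 (k - 1), Summable (fun n : ℕ => alphaTerm χ p α j (n + 1))) ∧
    (∀ j ∈ Finset.Icc 1 (k - 1), Summable (fun n : ℕ => betaTerm χ p β j n)) ∧
    (-(β : ℂ)) ^ ((p - 1) / 2) *
        ∑ j ∈ Finset.Icc 1 (k - 1), star χ (j : ZMod k) * ∑' n : ℕ, alphaTerm χ p α j (n + 1)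
      + 2 ^ p * (α : ℂ) ^ ((p - 1) / 2) * χ (-2) *
        ∑ j ∈ Finset.Icc 1 (k - 1), χ (j : ZMod k) * ∑' n : ℕ, betaTerm χ p β j n
      = (2 : ℂ) ^ ((p : ℤ) - 2) * (k / (p.factorial : ℂ)) *
        ∑ m ∈ Finset.Icc 1 p, (p.choose m : ℂ) * I ^ (p + 1 - m) *
          eulerCharFn (p - m) (star χ) 0 * bernoulliCharFn m χ 0 *
          ((α ^ ((p : ℝ) - m / 2) * β ^ (((p : ℝ) - 1 + m) / 2) : ℝ) : ℂ) := by
  have hk0 : 0 < k := hk.pos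
  have : NeZero k := ⟨hk0.ne'⟩
  have hp0 : p ≠ 0 := hp.pos.ne'
  refine ⟨fun j _ ↦ summable_alphaTerm χ hp0 hα j, fun j _ ↦ summable_betaTerm χ hp0 hβ j, ?_⟩
  have hkR : (k : ℝ) ≠ 0 := Nat.cast_ne_zero.2 hk0.ne'
  have hkC : (k : ℂ) ≠ 0 := Nat.cast_ne_zero.2 hk0.ne'
  have hπR := Real.pi_ne_zero
  have hπ : (Real.pi : ℂ) ≠ 0 := ofReal_ne_zero.2 Real.pi_ne_zero
  have hαC : (α : ℂ) ≠ 0 := ofReal_ne_zero.2 hα.ne'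
  have hβC : (β : ℂ) ≠ 0 := ofReal_ne_zero.2 hβ.ne'
  have hχ' : χ⁻¹ ≠ 1 := inv_ne_one.2 hχ
  have hκ : -(k * α / Real.pi) ≠ 0 := neg_ne_zero.2 (by positivity)
  -- This is where αβ = (π/k)² makes the dual parameter -1/κ the one belonging to β.
  have hκinv : -(-(k * α / Real.pi))⁻¹ = k * β / Real.pi := by
    have hβe : β = (Real.pi / k) ^ 2 / α := by rw [← hαβ]; field_simp
    rw [hβe]
    field_simp
  have ha : ∀ n : ℤ, χ (n : ZMod k) ≠ 0 → 1 / 2 ≤ |(n : ℝ) + 0| := by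
    intro n hn
    refine half_le_abs_int_add_zero ?_
    rintro rfl
    exact hn (by rw [Int.cast_zero, char_zero_eq_zero hχ])
  have hb : ∀ n : ℤ, χ⁻¹ (2 * (n : ZMod k)) ≠ 0 → 1 / 2 ≤ |(n : ℝ) + k / 2| := fun n _ ↦
    half_le_abs_int_add_half hk n
  have ha0 : ∑ j : Fin k, χ ((j : ℕ) : ZMod k) = 0 := by
    rw [← Finset.sum_range fun j ↦ χ (j : ZMod k), sum_range_char hχ]
  have hb0 : ∑ j : Fin k, χ⁻¹ (2 * ((j : ℕ) : ZMod k)) = 0 := by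
    rw [← Finset.sum_range fun j ↦ χ⁻¹ (2 * (j : ZMod k))]
    simp only [map_mul, ← Finset.mul_sum, sum_range_char hχ', mul_zero]
  have hrec := tsum_cotSum_reciprocity (a := fun r ↦ χ r) (b := fun r ↦ χ⁻¹ (2 * r)) ha hb ha0 hb0
    hκ hp0 (fun u hu ↦ tendsto_dirichletSum_char hχ hprim hu)
    (fun u hu ↦ tendsto_dirichletSum_char_odd hk hχ hprim hu)
  have hs1 := (tendsto_sum_div_pow_mul_poleSum (a := fun r ↦ χ r) (b := fun r ↦ χ⁻¹ (2 * r))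
    (k / 2) ha hb0 hκ hp0).1
  have hs2 := (tendsto_sum_div_pow_mul_poleSum (a := fun r ↦ χ⁻¹ (2 * r)) (b := fun r ↦ χ r)
    0 hb ha0 (neg_ne_zero.2 (inv_ne_zero hκ)) hp0).1
  rw [hκinv] at hs2 hrec
  rw [tsum_cotSum_eq_alpha hχ hp hα hs1, tsum_cotSum_eq_beta hk hχ hp hβ hs2] at hrec
  set S₁ := ∑ j ∈ Finset.Icc 1 (k - 1), star χ (j : ZMod k) * ∑' n : ℕ, alphaTerm χ p α j (n + 1)
  set S₂ := ∑ j ∈ Finset.Icc 1 (k - 1), χ (j : ZMod k) * ∑' n : ℕ, betaTerm χ p β j n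
  obtain ⟨g, hg⟩ := hp
  have hg1 : (p - 1) / 2 = g := by omega
  have hg2 : p - 1 = 2 * g := by omega
  have h2 : χ 2 * χ⁻¹ 2 = 1 := by
    have hu : IsUnit (2 : ZMod k) := by
      have := (ZMod.isUnit_iff_coprime 2 k).2 (Nat.coprime_two_left.2 hk)
      exact_mod_cast this
    rw [← MulChar.mul_apply, mul_inv_cancel, MulChar.one_apply hu]
  have hm2 : χ (-2) = χ (-1) * χ 2 := by rw [← map_mul, neg_one_mul]
  have hc : -(4 * Real.pi * I / k) ≠ 0 := by
    refine neg_ne_zero.2 (div_ne_zero (mul_ne_zero (mul_ne_zero (by norm_num) hπ) I_ne_zero) hkC)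
  have hpow : (-(β : ℂ)) ^ g * (((-(k * α / Real.pi) : ℝ) : ℂ) * I) ^ (p - 1) = (α : ℂ) ^ g := by
    have hβe : (β : ℂ) * (k ^ 2 * α) = Real.pi ^ 2 := by
      have : β * (k ^ 2 * α) = Real.pi ^ 2 := by
        rw [show β * (k ^ 2 * α) = k ^ 2 * (α * β) by ring, hαβ]
        field_simp
      exact_mod_cast congrArg ofReal this
    rw [hg2, pow_mul, ← mul_pow]
    congr 1
    rw [mul_pow, I_sq]
    push_cast
    field_simp
    linear_combination hβe
  refine mul_left_cancel₀ hc ?_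
  rw [hg1, hm2]
  -- Multiplying the reciprocity law by χ(2)(-β)^g clears the χ⁻¹(2) of the first series and, by
  -- `hpow`, turns (κi)^(p-1) into α^g.
  have hL : -(4 * Real.pi * I / k) * ((-(β : ℂ)) ^ g * S₁ + 2 ^ p * (α : ℂ) ^ g * (χ (-1) * χ 2) * S₂) =
      χ 2 * (-(β : ℂ)) ^ g * (-(4 * Real.pi * I / k) * χ⁻¹ 2 * S₁ +
        (((-(k * α / Real.pi) : ℝ) : ℂ) * I) ^ (p - 1) *
          (-(4 * Real.pi * I / k) * 2 ^ p * χ (-1) * S₂)) := by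
    linear_combination 4 * Real.pi * I / k * ((-(β : ℂ)) ^ g * S₁ * h2 +
      2 ^ p * χ (-1) * χ 2 * S₂ * hpow)
  rw [hL, hrec, ← Finset.sum_neg_distrib, Finset.mul_sum, Finset.mul_sum, Finset.mul_sum]
  refine Finset.sum_congr rfl fun u hu ↦ ?_
  rw [Finset.mem_Icc] at hu
  obtain ⟨w, rfl⟩ := Nat.exists_eq_add_of_le hu.2
  obtain ⟨t, rfl⟩ := Nat.exists_eq_add_of_le' hu.1
  have i1 : t + 1 + w - (t + 1) = w := by omega
  have i2 : t + 1 + w + 1 - (t + 1) = w + 1 := by omega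
  rw [rpow_mul_rpow_of_mul_eq_sq hα hβ (by positivity) hαβ (t + 1) w g hg, eulerCharFn_star_zero,
    bernoulliCharFn_zero hu.1, i1, i2, Nat.add_sub_cancel, Nat.add_sub_cancel]
  have hpar := char_neg_one_mul_sum_bernoulliFn hχ' (t + 1)
  rw [inv_char_neg_one] at hpar
  have hGG := gaussSum_mul_gaussSum_inv hprim
  have hG0 := gaussSum_ne_zero_of_isPrimitive hprim
  have hG0' := gaussSum_ne_zero_of_isPrimitive hprim.inv
  have hfac : ((t + 1 + w).choose (t + 1) : ℂ) * ((t + 1).factorial * w.factorial) =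
      (t + 1 + w).factorial := by
    have := Nat.choose_mul_factorial_mul_factorial hu.2
    rw [i1] at this
    rw [← mul_assoc]
    exact_mod_cast this
  have hGinv : (gaussSum χ⁻¹ ZMod.stdAddChar)⁻¹ * (gaussSum χ ZMod.stdAddChar)⁻¹ = χ (-1) / k := by
    rw [← mul_inv, mul_comm, hGG, mul_inv, div_eq_mul_inv,
      inv_eq_of_mul_eq_one_left (char_neg_one_mul_self χ)]
  set SB := ∑ s ∈ Finset.range k, χ⁻¹ (s : ZMod k) * (bernoulliFn (t + 1) ((s : ℝ) / k) : ℂ)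
  set SE := ∑ j ∈ Finset.range k, (-1) ^ j * χ (j : ZMod k) * (eulerFn w ((j : ℝ) / k) : ℂ)
  have f1 : (w.factorial : ℂ) ≠ 0 := Nat.cast_ne_zero.2 w.factorial_ne_zero
  have f2 : ((t + 1).factorial : ℂ) ≠ 0 := Nat.cast_ne_zero.2 (t + 1).factorial_ne_zero
  have f3 : ((t + 1 + w).factorial : ℂ) ≠ 0 := Nat.cast_ne_zero.2 (t + 1 + w).factorial_ne_zero
  have hz : (2 : ℂ) ^ (((t + 1 + w : ℕ) : ℤ) - 2) = 2 ^ (t + 1 + w) / 4 := by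
    rw [zpow_sub₀ two_ne_zero, zpow_natCast]
    norm_num
  have hch : ((t + 1 + w).choose (t + 1) : ℂ) / (t + 1 + w).factorial =
      1 / ((t + 1).factorial * w.factorial) := by
    rw [← hfac]
    have : ((t + 1 + w).choose (t + 1) : ℂ) ≠ 0 := by
      intro h0
      rw [h0, zero_mul] at hfac
      exact f3 hfac.symm
    field_simp
  have hI : I ^ (t + 1 + (w + 1)) = (-1) ^ (g + 1) := by
    rw [show t + 1 + (w + 1) = 2 * (g + 1) by omega, pow_mul, I_sq]
  have hs3 : (-1 : ℂ) ^ (t + 1) * (-1) ^ w = -1 := by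
    rw [← pow_add, hg, pow_succ, pow_mul]; norm_num
  have hs4 : (-1 : ℂ) ^ g * (-1) ^ g = 1 := by rw [← mul_pow]; norm_num
  rw [hz]
  -- The signs collected are (-1)^g from -β, (-1)^w from κ, (-1)^(g+1) from i^(p+1) and (-1)^(t+1)
  -- from parity; since t + 1 + w = p is odd, their product is 1.
  calc _ = (χ 2 * χ⁻¹ 2) * (β : ℂ) ^ g * ((-1) ^ g * (-1) ^ w) * (k * α / Real.pi) ^ w * I ^ w *
        (I ^ (t + 1 + (w + 1)) * (2 * Real.pi) ^ (t + 1 + (w + 1)) /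
          (2 * ((t + 1).factorial * w.factorial))) *
        ((gaussSum χ⁻¹ ZMod.stdAddChar)⁻¹ * (gaussSum χ ZMod.stdAddChar)⁻¹) * SB * SE := by
          rw [neg_pow (β : ℂ)]
          push_cast
          ring
    _ = (β : ℂ) ^ g * (-1) ^ g * (-1) ^ w * (k * α / Real.pi) ^ w * I ^ w *
        ((-1) ^ (g + 1) * (2 * Real.pi) ^ (t + 1 + (w + 1)) /
          (2 * ((t + 1).factorial * w.factorial))) / k * (χ (-1) * SB) * SE := by
          rw [h2, hGinv, hI]
          ring
    _ = (β : ℂ) ^ g * (k * α / Real.pi) ^ w * I ^ w * ((2 * Real.pi) ^ (t + 1 + (w + 1)) /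
          (2 * ((t + 1).factorial * w.factorial))) / k * SB * SE := by
          rw [hpar, pow_succ _ g]
          linear_combination (β : ℂ) ^ g * (k * α / Real.pi) ^ w * I ^ w *
            ((2 * Real.pi) ^ (t + 1 + (w + 1)) / (2 * ((t + 1).factorial * w.factorial))) / k *
            SB * SE * (-((-1) ^ g * (-1) ^ g) * hs3 + hs4)
    _ = -(4 * Real.pi * I / k) * (2 ^ (t + 1 + w) / 4 * k *
          (1 / ((t + 1).factorial * w.factorial)) * (I ^ (w + 1) *
          (k ^ w * SE) * (k ^ t * SB) * (α ^ w * β ^ g * (Real.pi / k) ^ (t + 1)))) := by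
          rw [pow_succ I w]
          simp only [pow_add, mul_pow, div_pow, pow_one]
          field_simp
          rw [I_sq]
          ring
    _ = _ := by
          rw [← hch]
          push_cast
          ring
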